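/- **Setting.** Let $\Omega=(0,1)$, $T>0$, $\gamma>0$, $\alpha_0>0$, $\alpha_1,\alpha_2\in\mathbb R$, let $u_0,v_0\in L^2(\Omega)$, and write $V_0^2=\{z\in H^2(\Omega): z=0\text{ on }\partial\Omega\}$. Let $$\mathcal D=\{d\in H^1(\Omega):\ \alpha_0\le d(x)\le\alpha_1 \text{ in }\Omega,\ \|d\|_{H^1(\Omega)}\le\alpha_2\}.$$ For $d\in\mathcal D$ consider the direct problem $$u_t+u_{xxxx}=v,\quad v_t-(d\,v_x)_x=0\ \text{ in }\Omega\times(0,T),\qquad u(0)=u_0,\ v(0)=v_0,\qquad u=u_{xx}=v=0\ \text{ on }\partial\Omega\times(0,T).$$ A weak solution is a pair $(u,v)\in L^2(0,T;V_0^2)\times L^2(0,T;H_0^1(\Omega))$ with $(u_t,v_t)\in L^2(0,T;(V_0^2)^*)\times L^2(0,T;H^{-1}(\Omega))$, whose representatives in $C([0,T];L^2(\Omega))$ take the initial values $u_0,v_0$, and such that for a.e. $t$ and all $\phi\in V_0^2$ $$\langle u_t,\phi\rangle+(u_{xx},\phi_{xx})=(v,\phi),\qquad \langle v_t,\phi\rangle+(d\,v_x,\phi_x)=0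 .$$ For final data $p_T,q_T\in L^2(\Omega)$ the adjoint problem is $$-p_t+p_{xxxx}=0,\quad -q_t-(d\,q_x)_x=p\ \text{ in }\Omega\times(0,T),\qquad p(T)=p_T,\ q(T)=q_T,\qquad p=p_{xx}=q=0\ \text{ on }\partial\Omega\times(0,T),$$ understood weakly in the same way. For $(m_1,m_2)\in L^2(\Omega)\times L^2(\Omega)$ let $$J_\gamma(d)=\tfrac12\|u(\cdot,T;d)-m_1\|_{L^2}^2+\tfrac12\|v(\cdot,T;d)-m_2\|_{L^2}^2+\tfrac\gamma2\|d\|_{H^1}^2,$$ where $(u(\cdot,\cdot\,;d),v(\cdot,\cdot\,;d))$ is the weak solution of the direct problem with coefficient $d$. **Theorem.** Let $(m_1,m_2)\in L^2(\Omega)\times L^2(\Omega)$ and $d\in\mathcal D$. The direct problem has a weak solution and its final state $(u(T),v(T))$ is uniquely determined, so that $J_\gamma$ is well defined on $\mathcal D$. There are a weak solution $(u,v)$ of the direct problem, a weak solution $(p,q)$ of the adjoint problem with $p_T=u(T)-m_1$, $q_T=v(T)-m_2$, and $\Lambda\in H^1(\Omega)$ whose derivative $\Lambda'$ is absolutely continuous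 on $[0,1]$ with $$\Lambda''-\Lambda=\int_0^T q_x v_x\,dt\quad\text{a.e. in }\Omega,\qquad \Lambda'(0)=\Lambda'(1)=0 .$$ For all such $(u,v)$, $(p,q)$ and $\Lambda$, the functional $J_\gamma$ is Fréchet differentiable at $d$ on $\mathcal D$ with gradient $J_\gamma'(d)=\Lambda+\gamma d$ in the Hilbert space $H^1(\Omega)$, that is, $$J_\gamma(\tilde d)=J_\gamma(d)+\big(\Lambda+\gamma d,\ \tilde d-d\big)_{H^1(\Omega)}+o\big(\|\tilde d-d\|_{H^1(\Omega)}\big)\qquad(\tilde d\to d \text{ in } H^1(\Omega),\ \tilde d\in\mathcal D).$$ If moreover $\alpha_0<\alpha_1$ and $\alpha_0<\alpha_2$, then $\Lambda+\gamma d$ is the only element of $H^1(\Omega)$ with this property. -/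

import Mathlib

open MeasureTheory Set
open scoped ContDiff InnerProductSpace

namespace Cascade

/-- Lebesgue measure on the spatial domain `Ω = (0,1)`. -/
noncomputable abbrev spaceMeasure : Measure ℝ := volume.restrict (Ioo (0 : ℝ) 1)

/-- Lebesgue measure on the time interval `(0,T)`. -/
noncomputable abbrev timeMeasure (T : ℝ) : Measure ℝ := volume.restrict (Ioo (0 : ℝ) T)

/-- The real Hilbert space `L²(0,1)`. -/
abbrev L2 : Type := Lp ℝ 2 spaceMeasure

/-- `φ ∈ C_c^∞(a,b)`. -/
structure IsTestFunction (a b : ℝ) (φ : ℝ → ℝ) : Prop where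
  contDiff : ContDiff ℝ ∞ φ
  hasCompactSupport : HasCompactSupport φ
  tsupport_subset : tsupport φ ⊆ Ioo a b

/-- `g` is the weak derivative of `f` on `(0,1)`. -/
def HasWeakDeriv (f g : L2) : Prop :=
  ∀ φ : ℝ → ℝ, IsTestFunction 0 1 φ →
    ∫ x, f x * deriv φ x ∂spaceMeasure = -∫ x, g x * φ x ∂spaceMeasure

theorem memLp_of_compact {ψ : ℝ → ℝ} (hc : Continuous ψ) (hs : HasCompactSupport ψ) :
    MemLp ψ 2 spaceMeasure :=
  (hc.memLp_of_hasCompactSupport hs (μ := volume)).restrict _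

theorem IsTestFunction.memLp {a b : ℝ} {φ : ℝ → ℝ} (h : IsTestFunction a b φ) :
    MemLp φ 2 spaceMeasure :=
  memLp_of_compact h.contDiff.continuous h.hasCompactSupport

theorem IsTestFunction.memLp_deriv {a b : ℝ} {φ : ℝ → ℝ} (h : IsTestFunction a b φ) :
    MemLp (deriv φ) 2 spaceMeasure :=
  memLp_of_compact (h.contDiff.continuous_deriv (by simp)) h.hasCompactSupport.deriv

theorem integral_mul_eq_inner {ψ : ℝ → ℝ} (h : MemLp ψ 2 spaceMeasure) (f : L2) :
    ∫ x, f x * ψ x ∂spaceMeasure = ⟪h.toLp ψ, f⟫_ℝ := by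
  rw [L2.inner_def]
  refine integral_congr_ae ?_
  filter_upwards [h.coeFn_toLp] with x hx
  simp [hx]

theorem hasWeakDeriv_iff (f g : L2) : HasWeakDeriv f g ↔
    ∀ (φ : ℝ → ℝ) (h : IsTestFunction 0 1 φ),
      ⟪h.memLp_deriv.toLp _, f⟫_ℝ = -⟪h.memLp.toLp _, g⟫_ℝ := by
  refine forall_congr' fun φ => forall_congr' fun h => ?_
  rw [integral_mul_eq_inner h.memLp_deriv, integral_mul_eq_inner h.memLp]

/-- The `m`-jets `(f, f', …, f⁽ᵐ⁾)` of functions with weak derivatives in `L²(0,1)` up to order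
`m`, inside `L²(0,1)^{m+1}` with its Hilbert norm. -/
def sobolevSubmodule (m : ℕ) : Submodule ℝ (PiLp 2 (fun _ : Fin (m + 1) => L2)) where
  carrier := {z | ∀ i : Fin m, HasWeakDeriv (z i.castSucc) (z i.succ)}
  zero_mem' := by
    intro i
    rw [hasWeakDeriv_iff]
    intro φ h
    simp
  add_mem' := by
    intro y z hy hz i
    have h1 := hy i
    have h2 := hz i
    rw [hasWeakDeriv_iff] at h1 h2 ⊢
    intro φ h
    simp only [PiLp.add_apply, inner_add_right, h1 φ h, h2 φ h]
    ring
  smul_mem' := by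
    intro c z hz i
    have h1 := hz i
    rw [hasWeakDeriv_iff] at h1 ⊢
    intro φ h
    simp only [PiLp.smul_apply, inner_smul_right, h1 φ h]
    ring

/-- The Sobolev space `H^m(0,1)`, with inner product `∑_{i ≤ m} (f⁽ⁱ⁾, g⁽ⁱ⁾)_{L²}`.
An element is recorded together with its (uniquely determined) weak derivatives. -/
def Sobolev (m : ℕ) : Type := ↥(sobolevSubmodule m)

noncomputable instance instNormedAddCommGroupSobolev (m : ℕ) : NormedAddCommGroup (Sobolev m) :=
  inferInstanceAs (NormedAddCommGroup ↥(sobolevSubmodule m))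

noncomputable instance instInnerProductSpaceSobolev (m : ℕ) : InnerProductSpace ℝ (Sobolev m) :=
  inferInstanceAs (InnerProductSpace ℝ ↥(sobolevSubmodule m))

/-- The `i`-th weak derivative `H^m(0,1) → L²(0,1)`; for `i = 0` this is the inclusion. -/
noncomputable def Sobolev.wd {m : ℕ} (i : Fin (m + 1)) : Sobolev m →L[ℝ] L2 :=
  (PiLp.proj 2 (fun _ : Fin (m + 1) => L2) i).comp (sobolevSubmodule m).subtypeL

theorem isClosed_sobolevSubmodule (m : ℕ) :
    IsClosed (sobolevSubmodule m : Set (PiLp 2 (fun _ : Fin (m + 1) => L2))) := by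
  have : (sobolevSubmodule m : Set (PiLp 2 (fun _ : Fin (m + 1) => L2))) =
      ⋂ (i : Fin m) (φ : ℝ → ℝ) (h : IsTestFunction 0 1 φ),
        {z | ⟪h.memLp_deriv.toLp _, z i.castSucc⟫_ℝ = -⟪h.memLp.toLp _, z i.succ⟫_ℝ} := by
    ext z
    simp only [mem_iInter, mem_ofPred_eq]
    exact forall_congr' fun i => hasWeakDeriv_iff _ _
  rw [this]
  refine isClosed_iInter fun i => isClosed_iInter fun φ => isClosed_iInter fun h => ?_
  refine isClosed_eq ?_ ?_
  · exact continuous_const.inner (PiLp.continuous_apply 2 _ i.castSucc)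
  · exact (continuous_const.inner (PiLp.continuous_apply 2 _ i.succ)).neg

instance instCompleteSpaceSobolev (m : ℕ) : CompleteSpace (Sobolev m) :=
  (isClosed_sobolevSubmodule m).completeSpace_coe

/-- `f = 0` on `∂Ω = {0, 1}`: the continuous representative of `f` vanishes at both end points. -/
def VanishesOnBoundary (f : L2) : Prop :=
  ∃ F : ℝ → ℝ, ContinuousOn F (Icc 0 1) ∧ (∀ᵐ x ∂spaceMeasure, f x = F x) ∧ F 0 = 0 ∧ F 1 = 0

theorem VanishesOnBoundary.zero : VanishesOnBoundary 0 :=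
  ⟨fun _ => 0, continuousOn_const, Lp.coeFn_zero ℝ 2 spaceMeasure, rfl, rfl⟩

theorem VanishesOnBoundary.add {f g : L2} (hf : VanishesOnBoundary f)
    (hg : VanishesOnBoundary g) : VanishesOnBoundary (f + g) := by
  obtain ⟨F, hF, hfF, hF0, hF1⟩ := hf
  obtain ⟨G, hG, hgG, hG0, hG1⟩ := hg
  refine ⟨fun x => F x + G x, hF.add hG, ?_, by simp [hF0, hG0], by simp [hF1, hG1]⟩
  filter_upwards [Lp.coeFn_add f g, hfF, hgG] with x h1 h2 h3
  rw [h1, Pi.add_apply, h2, h3]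

theorem VanishesOnBoundary.smul {f : L2} (c : ℝ) (hf : VanishesOnBoundary f) :
    VanishesOnBoundary (c • f) := by
  obtain ⟨F, hF, hfF, hF0, hF1⟩ := hf
  refine ⟨fun x => c * F x, continuousOn_const.mul hF, ?_, by simp [hF0], by simp [hF1]⟩
  filter_upwards [Lp.coeFn_smul c f, hfF] with x h1 h2
  rw [h1, Pi.smul_apply, h2, smul_eq_mul]

/-- `{z ∈ H^m(0,1) : z = 0 on ∂Ω}`, as a subspace of `H^m(0,1)`. -/
noncomputable def zeroBoundarySubmodule (m : ℕ) : Submodule ℝ (Sobolev m) where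
  carrier := {z | VanishesOnBoundary (Sobolev.wd 0 z)}
  zero_mem' := by simpa using VanishesOnBoundary.zero
  add_mem' := by
    intro y z hy hz
    simpa using VanishesOnBoundary.add hy hz
  smul_mem' := by
    intro c z hz
    simpa using VanishesOnBoundary.smul c hz

/-- The space `{z ∈ H^m(0,1) : z = 0 on ∂Ω}`, with the inner product of `H^m(0,1)`. -/
def ZeroBoundary (m : ℕ) : Type := ↥(zeroBoundarySubmodule m)

noncomputable instance instNormedAddCommGroupZeroBoundary (m : ℕ) :
    NormedAddCommGroup (ZeroBoundary m) :=
  inferInstanceAs (NormedAddCommGroup ↥(zeroBoundarySubmodule m))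

noncomputable instance instInnerProductSpaceZeroBoundary (m : ℕ) :
    InnerProductSpace ℝ (ZeroBoundary m) :=
  inferInstanceAs (InnerProductSpace ℝ ↥(zeroBoundarySubmodule m))

/-- The space `H¹₀(0,1)`. -/
abbrev H10 : Type := ZeroBoundary 1

/-- The space `V₀² = {z ∈ H²(0,1) : z = 0 on ∂Ω}`. -/
abbrev V02 : Type := ZeroBoundary 2

/-- The `i`-th weak derivative on `{z ∈ H^m(0,1) : z = 0 on ∂Ω}`. -/
noncomputable def wd {m : ℕ} (i : Fin (m + 1)) : ZeroBoundary m →L[ℝ] L2 :=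
  (Sobolev.wd i).comp (zeroBoundarySubmodule m).subtypeL

/-- The inclusion `V₀² ⊆ H¹₀(0,1)`. -/
noncomputable def V02.toH10 (z : V02) : H10 :=
  (⟨(⟨WithLp.toLp 2 fun i : Fin 2 => wd (m := 2) i.castSucc z, fun i => z.1.2 i.castSucc⟩ :
      ↥(sobolevSubmodule 1)), z.2⟩ : ↥(zeroBoundarySubmodule 1))

/-- `w ∈ L²(0,T;V*)` is the distributional time derivative of `u : (0,T) → V`, where
`V = {z ∈ H^m(0,1) : z = 0 on ∂Ω}` and `V ⊆ L²(0,1) ⊆ V*`. -/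
def HasTimeDeriv {m : ℕ} (T : ℝ) (u : ℝ → ZeroBoundary m)
    (w : ℝ → StrongDual ℝ (ZeroBoundary m)) : Prop :=
  MemLp w 2 (timeMeasure T) ∧
    ∀ η : ℝ → ℝ, IsTestFunction 0 T η → ∀ φ : ZeroBoundary m,
      ∫ t, deriv η t * ⟪wd 0 (u t), wd 0 φ⟫_ℝ ∂timeMeasure T =
        -∫ t, η t * w t φ ∂timeMeasure T

/-- `u(·,t₀) = a` for the representative of `u` in `C([0,T]; L²(0,1))`. -/
def HasTimeValue {m : ℕ} (T : ℝ) (u : ℝ → ZeroBoundary m) (t₀ : ℝ) (a : L2) : Prop :=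
  ∃ U : ℝ → L2, ContinuousOn U (Icc 0 T) ∧ (∀ᵐ t ∂timeMeasure T, wd 0 (u t) = U t) ∧ U t₀ = a

/-- `∫_Ω d v_x φ_x dx`. -/
noncomputable def diffusionForm (d : Sobolev 1) (v φ : H10) : ℝ :=
  ∫ x, Sobolev.wd 0 d x * wd 1 v x * wd 1 φ x ∂spaceMeasure

/-- `(u,v)` is the weak solution of
`u_t + u_xxxx = v`, `v_t - (d v_x)_x = 0` in `(0,1) × (0,T)`,
`u(0) = u₀`, `v(0) = v₀`, `u = u_xx = 0` and `v = 0` on `∂Ω × (0,T)`. -/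
structure IsDirectSolution (T : ℝ) (d : Sobolev 1) (u₀ v₀ : L2) (u : ℝ → V02) (v : ℝ → H10) :
    Prop where
  memLp_u : MemLp u 2 (timeMeasure T)
  memLp_v : MemLp v 2 (timeMeasure T)
  equation_u : ∃ u' : ℝ → StrongDual ℝ V02, HasTimeDeriv T u u' ∧
    ∀ᵐ t ∂timeMeasure T, ∀ φ : V02,
      u' t φ + ⟪wd 2 (u t), wd 2 φ⟫_ℝ = ⟪wd 0 (v t), wd 0 φ⟫_ℝ
  equation_v : ∃ v' : ℝ → StrongDual ℝ H10, HasTimeDeriv T v v' ∧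
    ∀ᵐ t ∂timeMeasure T, ∀ φ : V02, v' t φ.toH10 + diffusionForm d (v t) φ.toH10 = 0
  initial_u : HasTimeValue T u 0 u₀
  initial_v : HasTimeValue T v 0 v₀

/-- `(p,q)` is the weak solution of the final value problem
`-p_t + p_xxxx = 0`, `-q_t - (d q_x)_x = p` in `(0,1) × (0,T)`,
`p(T) = p_T`, `q(T) = q_T`, `p = p_xx = 0` and `q = 0` on `∂Ω × (0,T)`. -/
structure IsAdjointSolution (T : ℝ) (d : Sobolev 1) (pT qT : L2) (p : ℝ → V02) (q : ℝ → H10) :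
    Prop where
  memLp_p : MemLp p 2 (timeMeasure T)
  memLp_q : MemLp q 2 (timeMeasure T)
  equation_p : ∃ p' : ℝ → StrongDual ℝ V02, HasTimeDeriv T p p' ∧
    ∀ᵐ t ∂timeMeasure T, ∀ φ : V02, -p' t φ + ⟪wd 2 (p t), wd 2 φ⟫_ℝ = 0
  equation_q : ∃ q' : ℝ → StrongDual ℝ H10, HasTimeDeriv T q q' ∧
    ∀ᵐ t ∂timeMeasure T, ∀ φ : V02,
      -q' t φ.toH10 + diffusionForm d (q t) φ.toH10 = ⟪wd 0 (p t), wd 0 φ⟫_ℝ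
  final_p : HasTimeValue T p T pT
  final_q : HasTimeValue T q T qT

/-- `s = (u(·,T;d), v(·,T;d))` for a weak solution `(u,v)` of the direct problem. -/
def IsFinalState (T : ℝ) (u₀ v₀ : L2) (d : Sobolev 1) (s : L2 × L2) : Prop :=
  ∃ (u : ℝ → V02) (v : ℝ → H10), IsDirectSolution T d u₀ v₀ u v ∧
    HasTimeValue T u T s.1 ∧ HasTimeValue T v T s.2

open Classical in
/-- The final state `(u(·,T;d), v(·,T;d))` (zero if there is none). -/
noncomputable def finalState (T : ℝ) (u₀ v₀ : L2) (d : Sobolev 1) : L2 × L2 :=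
  if h : ∃ s, IsFinalState T u₀ v₀ d s then h.choose else 0

/-- The regularized Tikhonov functional
`J_γ(d) = ½ ‖u(·,T;d) - m₁‖² + ½ ‖v(·,T;d) - m₂‖² + (γ/2) ‖d‖²_{H¹}`. -/
noncomputable def tikhonov (T γ : ℝ) (u₀ v₀ m₁ m₂ : L2) (d : Sobolev 1) : ℝ :=
  1 / 2 * ‖(finalState T u₀ v₀ d).1 - m₁‖ ^ 2 + 1 / 2 * ‖(finalState T u₀ v₀ d).2 - m₂‖ ^ 2
    + γ / 2 * ‖d‖ ^ 2

/-- The set `𝒟` of admissible coefficients. -/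
def admissible (α₀ α₁ α₂ : ℝ) : Set (Sobolev 1) :=
  {d | (∀ᵐ x ∂spaceMeasure, α₀ ≤ Sobolev.wd 0 d x ∧ Sobolev.wd 0 d x ≤ α₁) ∧ ‖d‖ ≤ α₂}

/-- `∫₀ᵀ q_x v_x dt`, as a Bochner integral in `L¹(0,1)`
(the scalar action of `L²` on `L²` is the pointwise product, with values in `L¹`). -/
noncomputable def fluxProduct (T : ℝ) (v q : ℝ → H10) : Lp ℝ 1 spaceMeasure :=
  ∫ t, ((wd 1 (q t) : L2) • (wd 1 (v t) : L2) : Lp ℝ 1 spaceMeasure) ∂timeMeasure T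

/-- `Λ` solves `Λ'' - Λ = r` a.e. in `(0,1)`, `Λ'(0) = Λ'(1) = 0`: the derivative of `Λ` has an
absolutely continuous representative `G` on `[0,1]` with `G' - Λ = r` a.e., `G(0) = G(1) = 0`. -/
def IsNeumannSolution (r : Lp ℝ 1 spaceMeasure) (Λ : Sobolev 1) : Prop :=
  ∃ G : ℝ → ℝ, AbsolutelyContinuousOnInterval G 0 1 ∧
    (∀ᵐ x ∂spaceMeasure, Sobolev.wd 1 Λ x = G x) ∧
    (∀ᵐ x ∂spaceMeasure, DifferentiableAt ℝ G x ∧ deriv G x - Sobolev.wd 0 Λ x = r x) ∧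
    G 0 = 0 ∧ G 1 = 0

end Cascade

open Cascade

set_option linter.unusedSectionVars false

namespace Cascade

open Filter Topology

/-! ### Banach-valued primitives and weak derivatives on an interval -/

section Calculus

variable {E F : Type*} [NormedAddCommGroup E] [NormedSpace ℝ E] [CompleteSpace E]
  [NormedAddCommGroup F] [NormedSpace ℝ F] [CompleteSpace F]

/-! The argument is the adjoint method with a quadratic remainder. Let `e` be a second admissible
coefficient, let Δu, Δv be the differences of the two direct solutions, and let A_d be the operator
on H¹₀ representing the diffusion form. Then Δv solves the parabolic equation with operator A_e,
zero initial value and source -A_{e-d} v, so an energy estimate makes both Δv in L²(0,T;H¹₀) and the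
difference of the final states O(‖e-d‖) (`IsDirectPair.stability`). With `e = d` this is uniqueness
of the final state.

Expanding the squares in the functional leaves the cross terms (Δu(T), p(T)) + (Δv(T), q(T)),
because p(T), q(T) are the residuals. Pairing the equations for the differences with the adjoint
solution (`IsDirectPair.duality`) turns these terms into -∫⟨A_{e-d} v, q⟩ - ∫⟨A_{e-d} Δv, q⟩. The
second integral is quadratic in e-d. The first is the integral of -(e-d) against ∫ q_x v_x dt, which
the weak form of the Neumann problem identifies with the H¹ inner product of Λ and e-d
(`IsNeumannSolution.inner_eq`). Hence the expansion error is at most C‖e-d‖² (`tikhonov_expansion`).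
The gradient is unique when the admissible set is convex with nonempty interior.

The analytic basis is an abstract injection ι : V → H of Hilbert spaces, with V* identified with V
by Riesz. A weak time derivative w of u then means that G u, where G = ι*ι, is a V-valued primitive
of w. Applying (ε+G)⁻¹ to it gives regularizations for which the product rule is classical; letting
ε → 0 yields the continuous representative and integration by parts in time
(`IsWeakTimeDeriv.exists_limit`, `IsWeakTimeDeriv.inner_sub_inner`). Existence comes from Lions'
projection lemma (`exists_evolution`), and the backward problem from reversing time. -/

theorem absolutelyContinuousOnInterval_of_dist_le {X : Type*} [PseudoMetricSpace X] {f : ℝ → X}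
    {N : ℝ → ℝ} {a b C : ℝ} (hN : AbsolutelyContinuousOnInterval N a b)
    (h : ∀ x ∈ uIcc a b, ∀ y ∈ uIcc a b, dist (f x) (f y) ≤ C * dist (N x) (N y)) :
    AbsolutelyContinuousOnInterval f a b := by
  unfold AbsolutelyContinuousOnInterval at hN ⊢
  refine squeeze_zero' ?_ ?_ (by simpa using hN.const_mul C)
  · exact Eventually.of_forall fun _ => Finset.sum_nonneg fun _ _ => dist_nonneg
  rw [eventually_inf_principal]
  filter_upwards with E hE
  rw [Finset.mul_sum]
  exact Finset.sum_le_sum fun i hi => h _ (hE.1 i hi).1 _ (hE.1 i hi).2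

/-- The indefinite integral of `f'` is absolutely continuous by comparison with the real primitive
of ‖f'‖. Its difference from `f` is absolutely continuous with derivative zero almost everywhere,
hence constant. -/
theorem integral_eq_sub_of_absolutelyContinuous {f f' : ℝ → E} {a b : ℝ}
    (hf : AbsolutelyContinuousOnInterval f a b)
    (hi : IntervalIntegrable f' volume a b)
    (hd : ∀ᵐ x, x ∈ uIcc a b → HasDerivAt f (f' x) x) :
    ∫ x in a..b, f' x = f b - f a := by
  have hG : AbsolutelyContinuousOnInterval (fun x => ∫ t in a..x, f' t) a b := by
    refine absolutelyContinuousOnInterval_of_dist_le (C := 1)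
      (hi.norm.absolutelyContinuousOnInterval_intervalIntegral (c := a) (by simp)) ?_
    intro x hx y hy
    have hsub : ∀ z ∈ uIcc a b, IntervalIntegrable f' volume a z := fun z hz =>
      hi.mono_set (uIcc_subset_uIcc left_mem_uIcc hz)
    rw [dist_comm, dist_comm (∫ v in a..x, _), dist_eq_norm, one_mul, Real.dist_eq,
      intervalIntegral.integral_interval_sub_left (hsub y hy) (hsub x hx),
      intervalIntegral.integral_interval_sub_left (hsub y hy).norm (hsub x hx).norm]
    exact intervalIntegral.norm_integral_le_abs_integral_norm
  obtain ⟨C, hC⟩ := (hf.sub hG).const_of_ae_hasDerivAt_zero (by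
    filter_upwards [hd, hi.ae_hasDerivAt_integral] with x h1 h2 hx
    simpa using (h1 hx).sub (h2 hx a left_mem_uIcc))
  have h1 := hC a left_mem_uIcc
  have h2 := hC b right_mem_uIcc
  simp only [Pi.sub_apply, intervalIntegral.integral_same, sub_zero] at h1 h2
  rw [h1, ← h2]; abel

/-- The function `t ↦ x + ∫₀ᵗ w`. -/
noncomputable def primitive (x : E) (w : ℝ → E) (t : ℝ) : E := x + ∫ s in (0 : ℝ)..t, w s

theorem primitive_zero (x : E) (w : ℝ → E) : primitive x w 0 = x := by
  simp [primitive]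

variable {T : ℝ}

theorem intervalIntegrable_of_integrable {G : Type*} [NormedAddCommGroup G] (hT : 0 ≤ T)
    {w : ℝ → G} (hw : Integrable w (timeMeasure T)) : IntervalIntegrable w volume 0 T :=
  (intervalIntegrable_iff_integrableOn_Ioo_of_le hT).2 hw

theorem intervalIntegrable_sub {G : Type*} [NormedAddCommGroup G] (hT : 0 ≤ T) {w : ℝ → G}
    (hw : Integrable w (timeMeasure T)) {a b : ℝ} (ha : a ∈ Icc 0 T) (hb : b ∈ Icc 0 T) :
    IntervalIntegrable w volume a b :=
  (intervalIntegrable_of_integrable hT hw).mono_set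
    (by rw [uIcc_of_le hT]; exact uIcc_subset_Icc ha hb)

theorem intervalIntegral_eq_timeMeasure {G : Type*} [NormedAddCommGroup G] [NormedSpace ℝ G]
    (hT : 0 ≤ T) (w : ℝ → G) : ∫ t in (0 : ℝ)..T, w t = ∫ t, w t ∂timeMeasure T := by
  rw [intervalIntegral.integral_of_le hT, integral_Ioc_eq_integral_Ioo]

theorem primitive_sub (hT : 0 ≤ T) (x : E) {w : ℝ → E} (hw : Integrable w (timeMeasure T))
    {a b : ℝ} (ha : a ∈ Icc 0 T) (hb : b ∈ Icc 0 T) :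
    primitive x w b - primitive x w a = ∫ t in a..b, w t := by
  have h0 : (0 : ℝ) ∈ Icc 0 T := ⟨le_rfl, hT⟩
  simp only [primitive, add_sub_add_left_eq_sub]
  exact intervalIntegral.integral_interval_sub_left (intervalIntegrable_sub hT hw h0 hb)
    (intervalIntegrable_sub hT hw h0 ha)

/-- Two primitives are controlled by one scalar absolutely continuous function. -/
theorem dist_primitive_le (hT : 0 ≤ T) (x : E) {w : ℝ → E} {n : ℝ → ℝ}
    (hw : Integrable w (timeMeasure T)) (hn : Integrable n (timeMeasure T))
    (hwn : ∀ t, ‖w t‖ ≤ n t) {a b : ℝ} (ha : a ∈ Icc 0 T) (hb : b ∈ Icc 0 T) :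
    dist (primitive x w a) (primitive x w b) ≤ dist (primitive 0 n a) (primitive 0 n b) := by
  wlog hab : a ≤ b generalizing a b
  · rw [dist_comm, dist_comm (primitive 0 n a)]
    exact this hb ha (le_of_not_ge hab)
  rw [dist_comm, dist_comm (primitive 0 n a), dist_eq_norm, dist_eq_norm,
    primitive_sub hT x hw ha hb, primitive_sub hT 0 hn ha hb]
  refine (intervalIntegral.norm_integral_le_of_norm_le hab
    (Eventually.of_forall fun t _ => hwn t) (intervalIntegrable_sub hT hn ha hb)).trans ?_
  exact le_abs_self _

theorem absolutelyContinuous_primitive_real (hT : 0 ≤ T) (x : ℝ) {n : ℝ → ℝ}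
    (hn : Integrable n (timeMeasure T)) :
    AbsolutelyContinuousOnInterval (primitive x n) 0 T := by
  refine absolutelyContinuousOnInterval_of_dist_le (C := 1)
    ((intervalIntegrable_of_integrable hT hn).absolutelyContinuousOnInterval_intervalIntegral
      (c := 0) (by simp)) ?_
  intro a _ b _
  simp [primitive]

theorem absolutelyContinuous_primitive (hT : 0 ≤ T) (x : E) {w : ℝ → E}
    (hw : Integrable w (timeMeasure T)) :
    AbsolutelyContinuousOnInterval (primitive x w) 0 T := by
  refine absolutelyContinuousOnInterval_of_dist_le (C := 1)
    (absolutelyContinuous_primitive_real hT 0 hw.norm) ?_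
  intro a ha b hb
  rw [uIcc_of_le hT] at ha hb
  rw [one_mul]
  exact dist_primitive_le hT x hw hw.norm (fun _ => le_rfl) ha hb

theorem continuousOn_primitive (hT : 0 ≤ T) (x : E) {w : ℝ → E}
    (hw : Integrable w (timeMeasure T)) : ContinuousOn (primitive x w) (Icc 0 T) := by
  simpa [uIcc_of_le hT] using (absolutelyContinuous_primitive hT x hw).continuousOn

theorem ae_hasDerivAt_primitive (hT : 0 ≤ T) (x : E) {w : ℝ → E}
    (hw : Integrable w (timeMeasure T)) :
    ∀ᵐ t, t ∈ Icc 0 T → HasDerivAt (primitive x w) (w t) t := by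
  filter_upwards [(intervalIntegrable_of_integrable hT hw).ae_hasDerivAt_integral] with t ht h
  rw [uIcc_of_le hT] at ht
  exact (ht h 0 ⟨le_rfl, hT⟩).const_add x

theorem aestronglyMeasurable_of_continuousOn {f : ℝ → E} (hf : ContinuousOn f (Icc 0 T)) :
    AEStronglyMeasurable f (timeMeasure T) :=
  (hf.mono Ioo_subset_Icc_self).aestronglyMeasurable measurableSet_Ioo

theorem memLp_top_of_continuousOn {f : ℝ → E} (hf : ContinuousOn f (Icc 0 T)) :
    MemLp f ⊤ (timeMeasure T) := by
  obtain ⟨C, hC⟩ := isCompact_Icc.exists_bound_of_continuousOn hf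
  exact memLp_top_of_bound (aestronglyMeasurable_of_continuousOn hf) C
    ((ae_restrict_iff' measurableSet_Ioo).2
      (Eventually.of_forall fun t ht => hC t (Ioo_subset_Icc_self ht)))

theorem memLp_of_continuousOn {f : ℝ → E} (hf : ContinuousOn f (Icc 0 T)) (p : ENNReal) :
    MemLp f p (timeMeasure T) :=
  (memLp_top_of_continuousOn hf).mono_exponent le_top

/-- Leibniz rule for a bounded bilinear map applied to two primitives. -/
theorem bilinear_primitive_sub {G : Type*} [NormedAddCommGroup G] [NormedSpace ℝ G]
    [CompleteSpace G] (B : E →L[ℝ] F →L[ℝ] G) (hT : 0 ≤ T) (x : E) (y : F) {w : ℝ → E} {z : ℝ → F}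
    (hw : Integrable w (timeMeasure T)) (hz : Integrable z (timeMeasure T))
    {a b : ℝ} (ha : a ∈ Icc 0 T) (hb : b ∈ Icc 0 T) :
    ∫ t in a..b, (B (primitive x w t) (z t) + B (w t) (primitive y z t)) =
      B (primitive x w b) (primitive y z b) - B (primitive x w a) (primitive y z a) := by
  have hsub : uIcc a b ⊆ Icc 0 T := uIcc_subset_Icc ha hb
  have hX := continuousOn_primitive hT x hw
  have hY := continuousOn_primitive hT y hz
  obtain ⟨C, hC⟩ := isCompact_Icc.exists_bound_of_continuousOn hX
  obtain ⟨D, hD⟩ := isCompact_Icc.exists_bound_of_continuousOn hY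
  have hn : Integrable (fun t => ‖w t‖ + ‖z t‖) (timeMeasure T) := hw.norm.add hz.norm
  have hC0 : 0 ≤ C := (norm_nonneg _).trans (hC a ha)
  have hD0 : 0 ≤ D := (norm_nonneg _).trans (hD a ha)
  refine integral_eq_sub_of_absolutelyContinuous
    (f := fun t => B (primitive x w t) (primitive y z t)) ?_ ?_ ?_
  -- The primitive of ‖w‖ + ‖z‖ dominates the increments of both factors, so one scalar function
  -- controls the increments of the product.
  · refine absolutelyContinuousOnInterval_of_dist_le (C := ‖B‖ * C + ‖B‖ * D)
      ((absolutelyContinuous_primitive_real hT 0 hn).mono (by rwa [uIcc_of_le hT])) ?_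
    intro s hs t ht
    have h1 := dist_primitive_le hT x hw hn (fun t => by linarith [norm_nonneg (z t)])
      (hsub hs) (hsub ht)
    have h2 := dist_primitive_le hT y hz hn (fun t => by linarith [norm_nonneg (w t)])
      (hsub hs) (hsub ht)
    calc dist (B (primitive x w s) (primitive y z s)) (B (primitive x w t) (primitive y z t))
        ≤ dist (B (primitive x w s) (primitive y z s)) (B (primitive x w s) (primitive y z t)) +
          dist (B (primitive x w s) (primitive y z t))
            (B (primitive x w t) (primitive y z t)) := dist_triangle _ _ _
      _ ≤ ‖B‖ * C * dist (primitive y z s) (primitive y z t) +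
          ‖B‖ * D * dist (primitive x w s) (primitive x w t) := by
        simp only [dist_eq_norm]
        rw [← map_sub, ← _root_.sub_apply, ← map_sub]
        gcongr
        · refine (B.le_opNorm₂ _ _).trans ?_
          gcongr
          exact hC _ (hsub hs)
        · refine (B.le_opNorm₂ _ _).trans ?_
          rw [mul_right_comm]
          gcongr
          exact hD _ (hsub ht)
      _ ≤ _ := by
        rw [add_mul]
        gcongr
  · have hi : Integrable (fun t => B (primitive x w t) (z t) + B (w t) (primitive y z t))
        (timeMeasure T) := by
      refine Integrable.add ?_ ?_
      · exact memLp_one_iff_integrable.1 (B.memLp_of_bilin (p := ⊤) (q := 1) 1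
          (memLp_top_of_continuousOn hX) (memLp_one_iff_integrable.2 hz))
      · exact memLp_one_iff_integrable.1 (B.memLp_of_bilin (p := 1) (q := ⊤) 1
          (memLp_one_iff_integrable.2 hw) (memLp_top_of_continuousOn hY))
    exact intervalIntegrable_sub hT hi ha hb
  · filter_upwards [ae_hasDerivAt_primitive hT x hw, ae_hasDerivAt_primitive hT y hz]
      with t h1 h2 ht
    have h1' := h1 (hsub ht)
    have h2' := h2 (hsub ht)
    exact B.hasDerivAt_of_bilinear (fun _ => h1') (fun _ => h2')

theorem IsTestFunction.continuous {a b : ℝ} {η : ℝ → ℝ} (h : IsTestFunction a b η) :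
    Continuous η := h.contDiff.continuous

theorem IsTestFunction.eq_zero {a b : ℝ} {η : ℝ → ℝ} (h : IsTestFunction a b η) {t : ℝ}
    (ht : t ∉ Ioo a b) : η t = 0 :=
  image_eq_zero_of_notMem_tsupport fun h' => ht (h.tsupport_subset h')

theorem IsTestFunction.continuous_deriv {a b : ℝ} {η : ℝ → ℝ} (h : IsTestFunction a b η) :
    Continuous (deriv η) := h.contDiff.continuous_deriv (by simp)

theorem IsTestFunction.hasDerivAt {a b : ℝ} {η : ℝ → ℝ} (h : IsTestFunction a b η) (t : ℝ) :
    HasDerivAt η (deriv η t) t :=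
  (h.contDiff.differentiable (by simp) t).hasDerivAt

theorem IsTestFunction.eq_primitive {η : ℝ → ℝ} (h : IsTestFunction 0 T η) :
    η = primitive 0 (deriv η) := by
  ext t
  rw [primitive, intervalIntegral.integral_eq_sub_of_hasDerivAt (fun s _ => h.hasDerivAt s)
    (h.continuous_deriv.intervalIntegrable _ _), h.eq_zero (t := 0) (by simp)]
  simp

theorem integrable_of_continuous {f : ℝ → E} (hf : Continuous f) :
    Integrable f (timeMeasure T) :=
  memLp_one_iff_integrable.1 (memLp_of_continuousOn hf.continuousOn 1)

theorem integrable_continuous_smul {η : ℝ → ℝ} (hη : Continuous η) {f : ℝ → E}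
    (hf : Integrable f (timeMeasure T)) : Integrable (fun t => η t • f t) (timeMeasure T) :=
  memLp_one_iff_integrable.1 ((ContinuousLinearMap.lsmul ℝ ℝ (E := E)).memLp_of_bilin
    (p := ⊤) (q := 1) 1 (memLp_top_of_continuousOn hη.continuousOn)
    (memLp_one_iff_integrable.2 hf))

/-- Integration by parts of a primitive against a test function. -/
theorem integral_deriv_smul_primitive (hT : 0 ≤ T) (x : E) {w : ℝ → E}
    (hw : Integrable w (timeMeasure T)) {η : ℝ → ℝ} (hη : IsTestFunction 0 T η) :
    ∫ t, deriv η t • primitive x w t ∂timeMeasure T = -∫ t, η t • w t ∂timeMeasure T := by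
  have h := bilinear_primitive_sub (ContinuousLinearMap.lsmul ℝ ℝ (E := E)) hT 0 x
    (integrable_of_continuous (T := T) hη.continuous_deriv) hw
    (left_mem_Icc.2 hT) (right_mem_Icc.2 hT)
  rw [← hη.eq_primitive, hη.eq_zero (t := T) (by simp), hη.eq_zero (t := 0) (by simp),
    intervalIntegral_eq_timeMeasure hT] at h
  simp only [ContinuousLinearMap.lsmul_apply, zero_smul, sub_zero] at h
  rw [integral_add] at h
  · rw [eq_neg_iff_add_eq_zero, add_comm, h]
  · exact integrable_continuous_smul hη.continuous hw
  · exact integrable_continuous_smul hη.continuous_deriv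
      (memLp_one_iff_integrable.1 (memLp_of_continuousOn (continuousOn_primitive hT x hw) 1))

theorem exists_testFunction_integral_eq_one (hT : 0 < T) :
    ∃ η : ℝ → ℝ, IsTestFunction 0 T η ∧ ∫ t, η t ∂timeMeasure T = 1 := by
  obtain ⟨f, hf1, hf2, hf3, hf4, hf5⟩ := exists_contDiff_tsupport_subset (n := ⊤)
    (Ioo_mem_nhds (show 0 < T / 2 by linarith) (show T / 2 < T by linarith))
  have hf : IsTestFunction 0 T f := ⟨by simpa using hf3, hf2, hf1⟩
  have hpos : 0 < ∫ t, f t ∂timeMeasure T := by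
    rw [← intervalIntegral_eq_timeMeasure hT.le]
    refine intervalIntegral.integral_pos hT hf.continuous.continuousOn
      (fun t _ => (hf4 ⟨t, rfl⟩).1) ⟨T / 2, ⟨by linarith, by linarith⟩, by rw [hf5]; norm_num⟩
  refine ⟨fun t => (∫ t, f t ∂timeMeasure T)⁻¹ * f t, ⟨contDiff_const.mul hf.contDiff,
    hf2.mul_left, ?_⟩, ?_⟩
  · exact (tsupport_mul_subset_right (f := fun _ => _)).trans hf1
  · rw [integral_const_mul, inv_mul_cancel₀ hpos.ne']

theorem IsTestFunction.exists_Icc {η : ℝ → ℝ} (h : IsTestFunction 0 T η) (hT : 0 < T) :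
    ∃ a b, 0 < a ∧ b < T ∧ ∀ t, t ∉ Icc a b → η t = 0 := by
  rcases (tsupport η).eq_empty_or_nonempty with h0 | h0
  · exact ⟨T / 2, T / 2, by linarith, by linarith, fun t _ =>
      image_eq_zero_of_notMem_tsupport (by simp [h0])⟩
  · obtain ⟨a, ha⟩ := h.hasCompactSupport.isCompact.exists_isLeast h0
    obtain ⟨b, hb⟩ := h.hasCompactSupport.isCompact.exists_isGreatest h0
    exact ⟨a, b, (h.tsupport_subset ha.1).1, (h.tsupport_subset hb.1).2, fun t ht =>
      image_eq_zero_of_notMem_tsupport fun h' => ht ⟨ha.2 h', hb.2 h'⟩⟩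

/-- A test function of mean zero is the derivative of a test function. -/
theorem IsTestFunction.exists_deriv_eq {ψ : ℝ → ℝ} (h : IsTestFunction 0 T ψ) (hT : 0 < T)
    (h0 : ∫ t, ψ t ∂timeMeasure T = 0) : ∃ η, IsTestFunction 0 T η ∧ deriv η = ψ := by
  obtain ⟨a, b, ha, hb, hab⟩ := h.exists_Icc hT
  have hd : deriv (primitive 0 ψ) = ψ := by
    ext t
    exact ((h.continuous.integral_hasStrictDerivAt 0 t).hasDerivAt.const_add 0).deriv
  have hz : ∀ t, t ∉ Icc a b → primitive 0 ψ t = 0 := by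
    intro t ht
    rw [primitive, zero_add]
    -- To the left of the support (negative `t` included) the integrand vanishes between 0 and `t`.
    -- To the right of it, the mean-zero condition removes the integral up to `T` and only a piece
    -- beyond `b` remains.
    rcases lt_or_ge t a with h1 | h1
    · refine intervalIntegral.integral_zero_ae (Eventually.of_forall fun s hs => hab s fun h' => ?_)
      rcases uIoc_subset_uIcc hs with ⟨_, h2⟩
      exact absurd (h2.trans (max_le ha.le h1.le |>.trans h'.1)) (by
        have : max 0 t < a := max_lt ha h1
        exact not_le.2 (this.trans_le h'.1) |> fun h3 h4 => h3 h2)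
    · have h2 : b < t := by
        by_contra h2
        exact ht ⟨h1, not_lt.1 h2⟩
      rw [← intervalIntegral_eq_timeMeasure hT.le] at h0
      rw [← intervalIntegral.integral_add_adjacent_intervals
        (h.continuous.intervalIntegrable 0 T) (h.continuous.intervalIntegrable T t), h0, zero_add]
      refine intervalIntegral.integral_zero_ae (Eventually.of_forall fun s hs => hab s fun h' => ?_)
      rcases uIoc_subset_uIcc hs with ⟨h3, _⟩
      exact absurd (h3.trans h'.2) (not_le.2 (lt_min hb h2))
  have hs : tsupport (primitive 0 ψ) ⊆ Icc a b :=
    closure_minimal (fun t ht => by_contra fun h' => ht (hz t h')) isClosed_Icc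
  refine ⟨primitive 0 ψ, ⟨?_, isCompact_Icc.of_isClosed_subset (isClosed_tsupport _) hs,
    hs.trans (Icc_subset_Ioo ha hb)⟩, hd⟩
  rw [contDiff_infty_iff_deriv, hd]
  exact ⟨fun t => ((h.continuous.integral_hasStrictDerivAt 0 t).hasDerivAt.const_add
    0).differentiableAt, h.contDiff⟩

theorem ae_eq_zero_of_forall_testFunction {f : ℝ → E} (hf : Integrable f (timeMeasure T))
    (h : ∀ η, IsTestFunction 0 T η → ∫ t, η t • f t ∂timeMeasure T = 0) :
    ∀ᵐ t ∂timeMeasure T, f t = 0 := by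
  rw [ae_restrict_iff' measurableSet_Ioo]
  refine isOpen_Ioo.ae_eq_zero_of_integral_contDiff_smul_eq_zero
    (IntegrableOn.locallyIntegrableOn hf) fun g h1 h2 h3 => ?_
  have h4 : IsTestFunction 0 T g := ⟨h1, h2, h3⟩
  rw [← h g h4]
  refine (setIntegral_eq_integral_of_forall_compl_eq_zero fun t ht => ?_).symm
  rw [h4.eq_zero ht, zero_smul]

/-- A function whose weak derivative is integrable is a primitive. -/
theorem ae_eq_primitive_of_weakDeriv (hT : 0 < T) {f g : ℝ → E}
    (hf : Integrable f (timeMeasure T)) (hg : Integrable g (timeMeasure T))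
    (h : ∀ η, IsTestFunction 0 T η →
      ∫ t, deriv η t • f t ∂timeMeasure T = -∫ t, η t • g t ∂timeMeasure T) :
    ∃ x, ∀ᵐ t ∂timeMeasure T, f t = primitive x g t := by
  obtain ⟨η₀, hη₀, hη₁⟩ := exists_testFunction_integral_eq_one hT
  have hp : Integrable (primitive 0 g) (timeMeasure T) :=
    memLp_one_iff_integrable.1 (memLp_of_continuousOn (continuousOn_primitive hT.le 0 hg) 1)
  have hk := hf.sub hp
  have key : ∀ η, IsTestFunction 0 T η →
      ∫ t, deriv η t • (f - primitive 0 g) t ∂timeMeasure T = 0 := by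
    intro η hη
    simp only [Pi.sub_apply, smul_sub]
    rw [integral_sub (integrable_continuous_smul hη.continuous_deriv hf)
      (integrable_continuous_smul hη.continuous_deriv hp), h η hη,
      integral_deriv_smul_primitive hT.le 0 hg hη, sub_self]
  set k := f - primitive 0 g
  set x := ∫ t, η₀ t • k t ∂timeMeasure T
  refine ⟨x, ?_⟩
  have hx : ∀ᵐ t ∂timeMeasure T, k t - x = 0 := by
    refine ae_eq_zero_of_forall_testFunction (hk.sub (integrable_const x)) fun ψ hψ => ?_
    -- Du Bois-Reymond: subtracting a multiple of the normalized `η₀` gives mean zero, so the result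
    -- is the derivative of a test function and `key` applies. The subtracted part accounts for the
    -- constant `x`.
    have hψ' : IsTestFunction 0 T (fun t => ψ t - (∫ t, ψ t ∂timeMeasure T) * η₀ t) :=
      ⟨hψ.contDiff.sub (contDiff_const.mul hη₀.contDiff),
        hψ.hasCompactSupport.sub hη₀.hasCompactSupport.mul_left,
        (tsupport_sub _ _).trans (union_subset hψ.tsupport_subset
          ((tsupport_mul_subset_right (f := fun _ => _)).trans hη₀.tsupport_subset))⟩
    obtain ⟨η, hη, hηd⟩ := hψ'.exists_deriv_eq hT (by
      rw [integral_sub (integrable_of_continuous hψ.continuous)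
        ((integrable_of_continuous hη₀.continuous).const_mul _), integral_const_mul, hη₁]
      ring)
    have h1 := key η hη
    rw [hηd] at h1
    simp only [sub_smul, mul_smul] at h1
    have h2 : Integrable (fun t => (∫ t, ψ t ∂timeMeasure T) • η₀ t • k t) (timeMeasure T) :=
      (integrable_continuous_smul hη₀.continuous hk).smul _
    rw [integral_sub (integrable_continuous_smul hψ.continuous hk) h2, integral_smul] at h1
    simp only [smul_sub]
    rw [integral_sub (integrable_continuous_smul hψ.continuous hk)
      (integrable_continuous_smul hψ.continuous (integrable_const x)),
      integral_smul_const]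
    exact h1
  filter_upwards [hx] with t ht
  have : f t - primitive 0 g t = x := sub_eq_zero.1 ht
  rw [← sub_add_cancel (f t) (primitive 0 g t), this]
  simp [primitive]

end Calculus

theorem ae_timeMeasure_iff {T : ℝ} {p : ℝ → Prop} :
    (∀ᵐ t ∂timeMeasure T, p t) ↔ ∀ᵐ t, t ∈ Icc 0 T → p t := by
  rw [timeMeasure, Measure.restrict_congr_set Ioo_ae_eq_Icc, ae_restrict_iff' measurableSet_Icc]

/-! ### Continuous representatives and integration by parts in a Gelfand triple -/

section Gelfand

variable {V H : Type*} [NormedAddCommGroup V] [InnerProductSpace ℝ V] [CompleteSpace V]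
  [NormedAddCommGroup H] [InnerProductSpace ℝ H] [CompleteSpace H]

/-- Lax–Milgram applied to the bilinear form (x, y) ↦ ⟪A x, y⟫. -/
theorem exists_equiv_of_coercive (A : V →L[ℝ] V) {c : ℝ} (hc : 0 < c)
    (hA : ∀ x, c * ‖x‖ ^ 2 ≤ ⟪A x, x⟫_ℝ) : ∃ e : V ≃L[ℝ] V, ∀ x, e x = A x := by
  have hco : IsCoercive ((innerSL ℝ (E := V)).comp A) :=
    ⟨c, hc, fun x => by
      have := hA x
      simp only [ContinuousLinearMap.comp_apply, innerSL_apply_apply]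
      linarith [sq ‖x‖]⟩
  exact ⟨hco.continuousLinearEquivOfBilin, fun x =>
    (hco.unique_continuousLinearEquivOfBilin fun w => by simp).symm⟩

/-- The operator `ι* ι` on `V`, the Riesz representative of the pairing of `V` with itself
through `H`. -/
noncomputable def gram (ι : V →L[ℝ] H) : V →L[ℝ] V := (ContinuousLinearMap.adjoint ι).comp ι

theorem inner_gram_left (ι : V →L[ℝ] H) (x y : V) : ⟪gram ι x, y⟫_ℝ = ⟪ι x, ι y⟫_ℝ := by
  simp [gram, ContinuousLinearMap.adjoint_inner_left]

theorem inner_gram_right (ι : V →L[ℝ] H) (x y : V) : ⟪x, gram ι y⟫_ℝ = ⟪ι x, ι y⟫_ℝ := by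
  simp [gram, ContinuousLinearMap.adjoint_inner_right]

/-- A vector x orthogonal to the range is orthogonal to ι*ι x, which forces ‖ι x‖² = 0, and ι is
injective. -/
theorem dense_range_gram {ι : V →L[ℝ] H} (hι : Function.Injective ι) : DenseRange (gram ι) := by
  have h : (LinearMap.range (gram ι : V →ₗ[ℝ] V)).topologicalClosure = ⊤ := by
    rw [Submodule.topologicalClosure_eq_top_iff, Submodule.eq_bot_iff]
    intro x hx
    have h1 := (Submodule.mem_orthogonal _ _).1 hx (gram ι x) ⟨x, rfl⟩
    rw [inner_gram_left, inner_self_eq_zero] at h1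
    exact hι (by rw [h1, map_zero])
  intro x
  have : x ∈ ((LinearMap.range (gram ι : V →ₗ[ℝ] V)).topologicalClosure : Set V) := by
    rw [h]; trivial
  rwa [Submodule.topologicalClosure_coe, LinearMap.coe_range] at this

/-- Bounded operators `B n` commuting with `ι* ι` such that the contractions `B n (ι* ι)`
converge strongly to the identity. -/
structure IsRegularization (ι : V →L[ℝ] H) (B : ℕ → V →L[ℝ] V) : Prop where
  comm : ∀ n x, B n (gram ι x) = gram ι (B n x)
  norm_le : ∀ n x, ‖B n (gram ι x)‖ ≤ ‖x‖
  tendsto : ∀ x, Tendsto (fun n => B n (gram ι x)) atTop (𝓝 x)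

/-- Take B n = (ε + G)⁻¹ with G = ι*ι and ε = 1/(n+1). For s = B n (G x) one has ε s = G (x - s), so
ε⟪s, x - s⟫ = ‖ι(x - s)‖² ≥ 0, and therefore ‖s‖ ≤ ‖x‖. On the dense range of G the error is -ε B n
(G y), which tends to zero; the contraction bound extends this to all of V. -/
theorem exists_isRegularization {ι : V →L[ℝ] H} (hι : Function.Injective ι) :
    ∃ B, IsRegularization ι B := by
  set ε : ℕ → ℝ := fun n => 1 / ((n : ℝ) + 1)
  have hε : ∀ n, 0 < ε n := fun n => by positivity
  have hex : ∀ n, ∃ e : V ≃L[ℝ] V, ∀ x, e x = ε n • x + gram ι x := by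
    intro n
    obtain ⟨e, he⟩ := exists_equiv_of_coercive (ε n • ContinuousLinearMap.id ℝ V + gram ι) (hε n)
      (fun x => by
        simp only [_root_.add_apply, _root_.smul_apply, ContinuousLinearMap.id_apply,
          inner_add_left, inner_smul_left, inner_gram_left, real_inner_self_eq_norm_sq]
        have := sq_nonneg ‖ι x‖
        simp [this])
    exact ⟨e, fun x => by simp [he]⟩
  choose e he using hex
  have hcomm : ∀ n x, (e n).symm (gram ι x) = gram ι ((e n).symm x) := by
    intro n x
    rw [ContinuousLinearEquiv.symm_apply_eq, he]
    conv_lhs => rw [← (e n).apply_symm_apply x, he, map_add, map_smul]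
  have hle : ∀ n x, ‖(e n).symm (gram ι x)‖ ≤ ‖x‖ := by
    intro n x
    set s := (e n).symm (gram ι x)
    have hs : ε n • s + gram ι s = gram ι x := by rw [← he]; simp [s]
    have h1 : 0 ≤ ε n * ⟪s, x - s⟫_ℝ := by
      rw [← real_inner_smul_left, eq_sub_of_add_eq hs, ← map_sub, inner_gram_left]
      exact real_inner_self_nonneg
    have h2 := nonneg_of_mul_nonneg_right h1 (hε n)
    rw [inner_sub_right, real_inner_self_eq_norm_sq] at h2
    have h3 := real_inner_le_norm s x
    by_contra! h4
    nlinarith [norm_nonneg x]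
  refine ⟨fun n => (e n).symm, hcomm, hle, fun x => ?_⟩
  rw [Metric.tendsto_atTop]
  intro δ hδ
  obtain ⟨y, hy⟩ := (dense_range_gram hι).exists_dist_lt x (show 0 < δ / 3 by linarith)
  have hlim : Tendsto (fun n => ε n * ‖y‖) atTop (𝓝 0) := by
    simpa only [zero_mul] using (tendsto_one_div_add_atTop_nhds_zero_nat (𝕜 := ℝ)).mul_const ‖y‖
  obtain ⟨N, hN⟩ := (Metric.tendsto_atTop.1 hlim) (δ / 3) (by linarith)
  refine ⟨N, fun n hn => ?_⟩
  have h1 : (e n).symm (gram ι (gram ι y)) - gram ι y = -(ε n • (e n).symm (gram ι y)) := by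
    apply (e n).injective
    rw [map_sub, map_neg, map_smul]
    simp only [ContinuousLinearEquiv.apply_symm_apply]
    rw [he]
    abel
  have h2 : ‖(e n).symm (gram ι (gram ι y)) - gram ι y‖ < δ / 3 := by
    rw [h1, norm_neg, norm_smul, Real.norm_of_nonneg (hε n).le]
    refine (mul_le_mul_of_nonneg_left (hle n y) (hε n).le).trans_lt ?_
    have := hN n hn
    rw [Real.dist_eq, sub_zero] at this
    exact (le_abs_self _).trans_lt this
  have h3 : ‖(e n).symm (gram ι (x - gram ι y))‖ < δ / 3 :=
    (hle n _).trans_lt (by rwa [← dist_eq_norm])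
  rw [dist_eq_norm]
  have h4 : (e n).symm (gram ι x) - x = (e n).symm (gram ι (x - gram ι y)) +
      ((e n).symm (gram ι (gram ι y)) - gram ι y) + (gram ι y - x) := by
    rw [map_sub, map_sub]; abel
  change ‖(e n).symm (gram ι x) - x‖ < δ
  rw [h4]
  rw [dist_comm, dist_eq_norm] at hy
  linarith [norm_add₃_le (a := (e n).symm (gram ι (x - gram ι y)))
    (b := (e n).symm (gram ι (gram ι y)) - gram ι y) (c := gram ι y - x)]

/-- `w` represents the time derivative of `u` in `L²(0,T;V*)`, the dual of `V` being identified
with `V`. -/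
structure IsWeakTimeDeriv (ι : V →L[ℝ] H) (T : ℝ) (u w : ℝ → V) : Prop where
  memLp_left : MemLp u 2 (timeMeasure T)
  memLp_right : MemLp w 2 (timeMeasure T)
  weak : ∀ η, IsTestFunction 0 T η → ∀ φ : V,
    ∫ t, deriv η t * ⟪ι (u t), ι φ⟫_ℝ ∂timeMeasure T = -∫ t, η t * ⟪w t, φ⟫_ℝ ∂timeMeasure T

/-- `U` is a continuous representative of `ι ∘ u` on `[0,T]`. -/
structure IsContinuousRep (ι : V →L[ℝ] H) (T : ℝ) (u : ℝ → V) (U : ℝ → H) : Prop where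
  continuousOn : ContinuousOn U (Icc 0 T)
  ae_eq : ∀ᵐ t ∂timeMeasure T, ι (u t) = U t

variable {ι : V →L[ℝ] H} {T : ℝ}

theorem IsContinuousRep.eqOn {u : ℝ → V} {U U' : ℝ → H} (h : IsContinuousRep ι T u U)
    (h' : IsContinuousRep ι T u U') (hT : 0 < T) : EqOn U U' (Icc 0 T) := by
  refine Measure.eqOn_Icc_of_ae_eq volume hT.ne ?_ h.continuousOn h'.continuousOn
  rw [Measure.restrict_congr_set Ioo_ae_eq_Icc.symm]
  filter_upwards [h.ae_eq, h'.ae_eq] with t h1 h2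
  rw [← h1, h2]

theorem IsWeakTimeDeriv.integrable_left {u w : ℝ → V} (h : IsWeakTimeDeriv ι T u w) :
    Integrable u (timeMeasure T) := h.memLp_left.integrable one_le_two

theorem IsWeakTimeDeriv.integrable_right {u w : ℝ → V} (h : IsWeakTimeDeriv ι T u w) :
    Integrable w (timeMeasure T) := h.memLp_right.integrable one_le_two

/-- Since ⟪ι u, ι φ⟫ = ⟪G u, φ⟫ for every φ, the scalar identities say that G u has weak derivative
`w` in V, where vector-valued calculus applies. -/
theorem IsWeakTimeDeriv.exists_primitive {u w : ℝ → V} (h : IsWeakTimeDeriv ι T u w)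
    (hT : 0 < T) : ∃ x, ∀ᵐ t ∂timeMeasure T, gram ι (u t) = primitive x w t := by
  have hu := (gram ι).integrable_comp h.integrable_left
  refine ae_eq_primitive_of_weakDeriv hT hu h.integrable_right fun η hη => ?_
  refine ext_inner_left ℝ fun φ => ?_
  rw [inner_neg_right, ← integral_inner (integrable_continuous_smul hη.continuous_deriv hu),
    ← integral_inner (integrable_continuous_smul hη.continuous h.integrable_right)]
  simp_rw [inner_smul_right, inner_gram_right, real_inner_comm _ (ι φ), real_inner_comm _ φ]
  exact h.weak η hη φ

/-- The energy identity after regularization. -/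
theorem inner_regularized_sub (hT : 0 < T) {B C : V →L[ℝ] V}
    (hB : ∀ x, B (gram ι x) = gram ι (B x)) (hC : ∀ x, C (gram ι x) = gram ι (C x))
    {u w p z : ℝ → V} (hw : Integrable w (timeMeasure T)) (hz : Integrable z (timeMeasure T))
    {x y : V} (hx : ∀ᵐ t ∂timeMeasure T, gram ι (u t) = primitive x w t)
    (hy : ∀ᵐ t ∂timeMeasure T, gram ι (p t) = primitive y z t)
    {a b : ℝ} (ha : a ∈ Icc 0 T) (hb : b ∈ Icc 0 T) :
    ⟪ι (B (primitive x w b)), ι (C (primitive y z b))⟫_ℝ -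
      ⟪ι (B (primitive x w a)), ι (C (primitive y z a))⟫_ℝ =
    ∫ t in a..b, (⟪B (gram ι (u t)), C (gram ι (z t))⟫_ℝ +
      ⟪B (gram ι (w t)), C (gram ι (p t))⟫_ℝ) := by
  have h := bilinear_primitive_sub ((innerSL ℝ (E := H)).bilinearComp (ι.comp B) (ι.comp C))
    hT.le x y hw hz ha hb
  simp only [ContinuousLinearMap.bilinearComp_apply, ContinuousLinearMap.comp_apply,
    innerSL_apply_apply] at h
  rw [← h]
  refine intervalIntegral.integral_congr_ae ?_
  rw [ae_timeMeasure_iff] at hx hy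
  filter_upwards [hx, hy] with t h1 h2 ht
  have ht' : t ∈ Icc 0 T := uIcc_subset_Icc ha hb (uIoc_subset_uIcc ht)
  -- The adjoint of ι moves to the other factor and G commutes past `B` and `C`. Only products of
  -- V-valued functions remain, and these survive the limit of the regularization.
  rw [← h1 ht', ← h2 ht', ← inner_gram_right, ← inner_gram_left, hC (z t), hB (w t)]

theorem integrable_inner_of_memLp {E : Type*} [NormedAddCommGroup E] [InnerProductSpace ℝ E]
    {α : Type*} [MeasurableSpace α] {μ : Measure α} {f g : α → E} (hf : MemLp f 2 μ)
    (hg : MemLp g 2 μ) : Integrable (fun t => ⟪f t, g t⟫_ℝ) μ :=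
  memLp_one_iff_integrable.1 ((innerSL ℝ (E := E)).memLp_of_bilin 1 hf hg)

theorem integrable_norm_sq_of_memLp {E : Type*} [NormedAddCommGroup E]
    {α : Type*} [MeasurableSpace α] {μ : Measure α} {f : α → E} (hf : MemLp f 2 μ) :
    Integrable (fun t => ‖f t‖ ^ 2) μ := hf.norm.integrable_sq

theorem IsRegularization.tendsto_integral_norm_sub_sq {B : ℕ → V →L[ℝ] V}
    (hB : IsRegularization ι B) {u : ℝ → V} (hu : MemLp u 2 (timeMeasure T)) :
    Tendsto (fun n => ∫ t, ‖B n (gram ι (u t)) - u t‖ ^ 2 ∂timeMeasure T) atTop (𝓝 0) := by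
  have h := tendsto_integral_of_dominated_convergence (μ := timeMeasure T)
    (F := fun n t => ‖B n (gram ι (u t)) - u t‖ ^ 2) (f := fun _ => 0) (fun t => 4 * ‖u t‖ ^ 2)
    (fun n => ?_) ((integrable_norm_sq_of_memLp hu).const_mul 4) (fun n => ?_) ?_
  · simpa using h
  · exact ((((B n).comp (gram ι)).comp_memLp' hu).sub hu).aestronglyMeasurable.norm.pow 2
  · refine Eventually.of_forall fun t => ?_
    have h1 := norm_sub_le (B n (gram ι (u t))) (u t)
    have h2 := hB.norm_le n (u t)
    rw [Real.norm_of_nonneg (by positivity)]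
    nlinarith [norm_nonneg (B n (gram ι (u t)) - u t), norm_nonneg (u t)]
  · refine Eventually.of_forall fun t => ?_
    have := ((hB.tendsto (u t)).sub_const (u t)).norm.pow 2
    simpa using this

theorem norm_sub_sq_le_two {E : Type*} [NormedAddCommGroup E] (x y z : E) :
    ‖x - y‖ ^ 2 ≤ 2 * ‖x - z‖ ^ 2 + 2 * ‖y - z‖ ^ 2 := by
  have h := norm_sub_le_norm_sub_add_norm_sub x z y
  rw [norm_sub_rev z y] at h
  nlinarith [norm_nonneg (x - y), sq_nonneg (‖x - z‖ - ‖y - z‖)]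

/-- The continuous representative in `H`, as the limit of the regularizations. -/
theorem IsWeakTimeDeriv.exists_limit {u w : ℝ → V} (h : IsWeakTimeDeriv ι T u w) (hT : 0 < T)
    {B : ℕ → V →L[ℝ] V} (hB : IsRegularization ι B) {x : V}
    (hx : ∀ᵐ t ∂timeMeasure T, gram ι (u t) = primitive x w t) :
    ∃ U : ℝ → H, IsContinuousRep ι T u U ∧
      ∀ t ∈ Icc 0 T, Tendsto (fun n => ι (B n (primitive x w t))) atTop (𝓝 (U t)) := by
  -- The energy identity needs a base point where the regularizations are known to converge. The
  -- endpoint 0 is unsuitable, since `u` is only determined almost everywhere; at `a` the primitive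
  -- lies in the range of `gram ι`.
  obtain ⟨a, ha, hax⟩ : ∃ a ∈ Icc 0 T, gram ι (u a) = primitive x w a := by
    have : NeZero (timeMeasure T) := ⟨by simp [Measure.restrict_eq_zero, hT]⟩
    obtain ⟨a, ha⟩ := (hx.and (ae_restrict_mem measurableSet_Ioo)).exists
    exact ⟨a, Ioo_subset_Icc_self ha.2, ha.1⟩
  set e : ℕ → ℝ := fun n => 2 * ‖ι (B n (gram ι (u a))) - ι (u a)‖ ^ 2 +
    (2 * ∫ t, ‖B n (gram ι (u t)) - u t‖ ^ 2 ∂timeMeasure T) +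
    2 * ∫ t, ‖B n (gram ι (w t)) - w t‖ ^ 2 ∂timeMeasure T
  have he : Tendsto e atTop (𝓝 0) := by
    have h1 := ((((ι.continuous.tendsto _).comp (hB.tendsto (u a))).sub_const
      (ι (u a))).norm.pow 2).const_mul 2
    have h2 := (hB.tendsto_integral_norm_sub_sq h.memLp_left).const_mul 2
    have h3 := (hB.tendsto_integral_norm_sub_sq h.memLp_right).const_mul 2
    simpa using (h1.add h2).add h3
  set f : ℕ → ℝ → H := fun n t => ι (B n (primitive x w t))
  have hint : ∀ (n : ℕ) {v : ℝ → V}, MemLp v 2 (timeMeasure T) →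
      Integrable (fun t => ‖B n (gram ι (v t)) - v t‖ ^ 2) (timeMeasure T) := fun n v hv =>
    integrable_norm_sq_of_memLp ((((B n).comp (gram ι)).comp_memLp' hv).sub hv)
  -- The energy identity for the difference operator `B n - B m`, from `a` to `t`. The bound does
  -- not depend on `t`, so the regularizations are uniformly Cauchy and the limit is continuous.
  have key : ∀ n m, ∀ t ∈ Icc 0 T, ‖f n t - f m t‖ ^ 2 ≤ e n + e m := by
    intro n m t ht
    have hD : ∀ y, (B n - B m) (gram ι y) = gram ι ((B n - B m) y) := fun y => by
      simp only [_root_.sub_apply, map_sub, hB.comm]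
    have hid := inner_regularized_sub hT hD hD h.integrable_right h.integrable_right hx hx ha ht
    simp only [real_inner_self_eq_norm_sq] at hid
    have hft : ι ((B n - B m) (primitive x w t)) = f n t - f m t := by simp [f]
    rw [hft, ← hax] at hid
    have h1 : ‖ι ((B n - B m) (gram ι (u a)))‖ ^ 2 ≤
        2 * ‖ι (B n (gram ι (u a))) - ι (u a)‖ ^ 2 +
        2 * ‖ι (B m (gram ι (u a))) - ι (u a)‖ ^ 2 := by
      rw [_root_.sub_apply, map_sub]
      exact norm_sub_sq_le_two _ _ _
    set g : ℝ → ℝ := fun t => (2 * ‖B n (gram ι (u t)) - u t‖ ^ 2 +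
      2 * ‖B m (gram ι (u t)) - u t‖ ^ 2) + (2 * ‖B n (gram ι (w t)) - w t‖ ^ 2 +
      2 * ‖B m (gram ι (w t)) - w t‖ ^ 2)
    have hg : Integrable g (timeMeasure T) :=
      (((hint n h.memLp_left).const_mul 2).add ((hint m h.memLp_left).const_mul 2)).add
        (((hint n h.memLp_right).const_mul 2).add ((hint m h.memLp_right).const_mul 2))
    have h2 : |∫ s in a..t, (⟪(B n - B m) (gram ι (u s)), (B n - B m) (gram ι (w s))⟫_ℝ +
        ⟪(B n - B m) (gram ι (w s)), (B n - B m) (gram ι (u s))⟫_ℝ)| ≤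
        ∫ s, g s ∂timeMeasure T := by
      rw [← intervalIntegral_eq_timeMeasure hT.le]
      have hgi := intervalIntegrable_of_integrable hT.le hg
      have hg0 : ∀ s, 0 ≤ g s := fun s => by positivity
      have h3 : |∫ s in a..t, g s| ≤ ∫ s in (0 : ℝ)..T, g s := by
        rw [← abs_of_nonneg (intervalIntegral.integral_nonneg hT.le fun s _ => hg0 s)]
        refine intervalIntegral.abs_integral_mono_interval ?_
          (Eventually.of_forall hg0) hgi
        rw [uIoc_of_le hT.le]
        intro s hs
        rcases hs with ⟨hs1, hs2⟩
        exact ⟨(le_inf ha.1 ht.1).trans_lt hs1, hs2.trans (sup_le ha.2 ht.2)⟩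
      refine le_trans ?_ h3
      rw [← Real.norm_eq_abs]
      refine intervalIntegral.norm_integral_le_abs_of_norm_le
        (Eventually.of_forall fun s => ?_) (intervalIntegrable_sub hT.le hg ha ht)
      have h4 := norm_sub_sq_le_two (B n (gram ι (u s))) (B m (gram ι (u s))) (u s)
      have h5 := norm_sub_sq_le_two (B n (gram ι (w s))) (B m (gram ι (w s))) (w s)
      simp only [_root_.sub_apply]
      set X := B n (gram ι (u s)) - B m (gram ι (u s))
      set Y := B n (gram ι (w s)) - B m (gram ι (w s))
      rw [real_inner_comm X Y, ← two_mul, Real.norm_eq_abs, abs_mul, abs_two]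
      have h6 := abs_real_inner_le_norm X Y
      calc 2 * |⟪X, Y⟫_ℝ| ≤ ‖X‖ ^ 2 + ‖Y‖ ^ 2 := by nlinarith [sq_nonneg (‖X‖ - ‖Y‖)]
        _ ≤ g s := add_le_add h4 h5
    have h3 : ∫ s, g s ∂timeMeasure T =
        ((2 * ∫ t, ‖B n (gram ι (u t)) - u t‖ ^ 2 ∂timeMeasure T) +
          2 * ∫ t, ‖B m (gram ι (u t)) - u t‖ ^ 2 ∂timeMeasure T) +
        ((2 * ∫ t, ‖B n (gram ι (w t)) - w t‖ ^ 2 ∂timeMeasure T) +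
          2 * ∫ t, ‖B m (gram ι (w t)) - w t‖ ^ 2 ∂timeMeasure T) := by
      have i1 := (hint n h.memLp_left).const_mul 2
      have i2 := (hint m h.memLp_left).const_mul 2
      have i3 := (hint n h.memLp_right).const_mul 2
      have i4 := (hint m h.memLp_right).const_mul 2
      refine (integral_add (i1.add i2) (i3.add i4)).trans ?_
      refine congrArg₂ (· + ·) ((integral_add i1 i2).trans ?_) ((integral_add i3 i4).trans ?_) <;>
        simp only [integral_const_mul]
    have h4 := le_of_abs_le h2
    simp only [e]
    linarith
  have hcau : ∀ t ∈ Icc 0 T, CauchySeq fun n => f n t := by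
    intro t ht
    rw [Metric.cauchySeq_iff]
    intro δ hδ
    obtain ⟨N, hN⟩ :=
      (he.eventually (gt_mem_nhds (show 0 < δ ^ 2 / 2 by positivity))).exists_forall_of_atTop
    refine ⟨N, fun n hn m hm => ?_⟩
    rw [dist_eq_norm]
    refine lt_of_pow_lt_pow_left₀ 2 hδ.le ((key n m t ht).trans_lt ?_)
    linarith [hN n hn, hN m hm]
  have hlim : ∀ t, ∃ y, t ∈ Icc 0 T → Tendsto (fun n => f n t) atTop (𝓝 y) := by
    intro t
    by_cases ht : t ∈ Icc 0 T
    · obtain ⟨y, hy⟩ := cauchySeq_tendsto_of_complete (hcau t ht)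
      exact ⟨y, fun _ => hy⟩
    · exact ⟨0, fun h' => absurd h' ht⟩
  choose U hU using hlim
  have hle : ∀ n, ∀ t ∈ Icc 0 T, ‖f n t - U t‖ ^ 2 ≤ e n := by
    intro n t ht
    have h1 := ((hU t ht).const_sub (f n t)).norm.pow 2
    have h2 := he.const_add (e n)
    rw [add_zero] at h2
    exact le_of_tendsto_of_tendsto' h1 h2 fun m => key n m t ht
  refine ⟨U, ⟨?_, ?_⟩, fun t ht => hU t ht⟩
  · have hu : TendstoUniformlyOn f U atTop (Icc 0 T) := by
      rw [Metric.tendstoUniformlyOn_iff]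
      intro δ hδ
      filter_upwards [he.eventually (gt_mem_nhds (show 0 < δ ^ 2 by positivity))] with n hn t ht
      rw [dist_comm, dist_eq_norm]
      exact lt_of_pow_lt_pow_left₀ 2 hδ.le ((hle n t ht).trans_lt hn)
    refine hu.continuousOn (Frequently.of_forall fun n => ?_)
    exact (ι.comp (B n)).continuous.comp_continuousOn
      (continuousOn_primitive hT.le x h.integrable_right)
  · filter_upwards [hx, ae_restrict_mem measurableSet_Ioo] with t h1 h2
    refine tendsto_nhds_unique ?_ (hU t (Ioo_subset_Icc_self h2))
    simp only [f, ← h1]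
    exact (ι.continuous.tendsto _).comp (hB.tendsto (u t))

theorem IsWeakTimeDeriv.exists_continuousRep (hι : Function.Injective ι) {u w : ℝ → V}
    (h : IsWeakTimeDeriv ι T u w) (hT : 0 < T) : ∃ U, IsContinuousRep ι T u U := by
  obtain ⟨B, hB⟩ := exists_isRegularization hι
  obtain ⟨x, hx⟩ := h.exists_primitive hT
  obtain ⟨U, hU, -⟩ := h.exists_limit hT hB hx
  exact ⟨U, hU⟩

/-- Integration by parts in time in the Gelfand triple `V ⊆ H ⊆ V*`. -/
theorem IsWeakTimeDeriv.inner_sub_inner (hι : Function.Injective ι) (hT : 0 < T)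
    {u w p z : ℝ → V} (hu : IsWeakTimeDeriv ι T u w) (hp : IsWeakTimeDeriv ι T p z)
    {U P : ℝ → H} (hU : IsContinuousRep ι T u U) (hP : IsContinuousRep ι T p P) :
    ⟪U T, P T⟫_ℝ - ⟪U 0, P 0⟫_ℝ = ∫ t, (⟪u t, z t⟫_ℝ + ⟪w t, p t⟫_ℝ) ∂timeMeasure T := by
  obtain ⟨B, hB⟩ := exists_isRegularization hι
  obtain ⟨x, hx⟩ := hu.exists_primitive hT
  obtain ⟨y, hy⟩ := hp.exists_primitive hT
  obtain ⟨U', hU', hUl⟩ := hu.exists_limit hT hB hx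
  obtain ⟨P', hP', hPl⟩ := hp.exists_limit hT hB hy
  have h0 : (0 : ℝ) ∈ Icc 0 T := left_mem_Icc.2 hT.le
  have h1 : T ∈ Icc 0 T := right_mem_Icc.2 hT.le
  rw [hU.eqOn hU' hT h0, hU.eqOn hU' hT h1, hP.eqOn hP' hT h0, hP.eqOn hP' hT h1]
  have hL := ((hUl T h1).inner (𝕜 := ℝ) (hPl T h1)).sub ((hUl 0 h0).inner (𝕜 := ℝ) (hPl 0 h0))
  refine tendsto_nhds_unique hL ?_
  simp_rw [fun n => inner_regularized_sub hT (hB.comm n) (hB.comm n) hu.integrable_right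
    hp.integrable_right hx hy h0 h1, intervalIntegral_eq_timeMeasure hT.le]
  have hS : ∀ n {v : ℝ → V}, MemLp v 2 (timeMeasure T) →
      MemLp (fun t => B n (gram ι (v t))) 2 (timeMeasure T) := fun n v hv =>
    ((B n).comp (gram ι)).comp_memLp' hv
  -- The regularized identity passes to the limit: its integrand converges pointwise, and
  -- contractivity gives an integrable majorant independent of `n`.
  refine tendsto_integral_of_dominated_convergence
    (fun t => ‖u t‖ * ‖z t‖ + ‖w t‖ * ‖p t‖) (fun n => ?_) ?_ (fun n => ?_) ?_
  · exact ((integrable_inner_of_memLp (hS n hu.memLp_left) (hS n hp.memLp_right)).add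
      (integrable_inner_of_memLp (hS n hu.memLp_right)
        (hS n hp.memLp_left))).aestronglyMeasurable
  · exact (hu.memLp_left.norm.integrable_mul hp.memLp_right.norm).add
      (hu.memLp_right.norm.integrable_mul hp.memLp_left.norm)
  · refine Eventually.of_forall fun t => (norm_add_le _ _).trans (add_le_add ?_ ?_)
    · exact (norm_inner_le_norm _ _).trans (mul_le_mul (hB.norm_le n _) (hB.norm_le n _)
        (norm_nonneg _) (norm_nonneg _))
    · exact (norm_inner_le_norm _ _).trans (mul_le_mul (hB.norm_le n _) (hB.norm_le n _)
        (norm_nonneg _) (norm_nonneg _))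
  · exact Eventually.of_forall fun t =>
      ((hB.tendsto _).inner (hB.tendsto _)).add ((hB.tendsto _).inner (hB.tendsto _))

end Gelfand

/-! ### Weak solvability and energy estimate for abstract evolution equations -/

/-- Lions' projection lemma. -/
theorem exists_inner_eq_of_abs_le {Φ W : Type*} [AddCommGroup Φ] [Module ℝ Φ]
    [NormedAddCommGroup W] [InnerProductSpace ℝ W] [CompleteSpace W] (K : Φ →ₗ[ℝ] W)
    (L : Φ →ₗ[ℝ] ℝ) {C : ℝ} (h : ∀ φ, |L φ| ≤ C * ‖K φ‖) : ∃ u : W, ∀ φ, ⟪u, K φ⟫_ℝ = L φ := by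
  -- The estimate lets `L` factor through the range of `K` as a bounded functional. Hahn–Banach
  -- extends it to `W`, and Riesz represents the extension.
  have hker : LinearMap.ker K ≤ LinearMap.ker L := fun φ hφ => by
    have h1 := h φ
    rw [LinearMap.mem_ker.1 hφ, norm_zero, mul_zero] at h1
    exact LinearMap.mem_ker.2 (abs_nonpos_iff.1 h1)
  let g : LinearMap.range K →ₗ[ℝ] ℝ :=
    ((LinearMap.ker K).liftQ L hker).comp K.quotKerEquivRange.symm.toLinearMap
  have hg : ∀ φ, g ⟨K φ, φ, rfl⟩ = L φ := by
    intro φ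
    have : K.quotKerEquivRange.symm ⟨K φ, φ, rfl⟩ = (LinearMap.ker K).mkQ φ := by
      rw [LinearEquiv.symm_apply_eq]
      rfl
    simp [g, this]
  let g' : StrongDual ℝ (LinearMap.range K) := g.mkContinuous C (by
    rintro ⟨_, φ, rfl⟩
    rw [hg]
    exact h φ)
  obtain ⟨e, he, -⟩ := exists_extension_norm_eq (LinearMap.range K) g'
  refine ⟨(InnerProductSpace.toDual ℝ W).symm e, fun φ => ?_⟩
  rw [InnerProductSpace.toDual_symm_apply]
  exact (he ⟨K φ, φ, rfl⟩).trans (hg φ)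

section Evolution

variable {V H : Type*} [NormedAddCommGroup V] [InnerProductSpace ℝ V] [CompleteSpace V]
  [NormedAddCommGroup H] [InnerProductSpace ℝ H] [CompleteSpace H]
variable {ι : V →L[ℝ] H} {T : ℝ}

theorem integrable_mul_inner {η : ℝ → ℝ} (hη : Continuous η) {u : ℝ → V}
    (hu : Integrable u (timeMeasure T)) (φ : V) :
    Integrable (fun t => η t * ⟪u t, φ⟫_ℝ) (timeMeasure T) :=
  integrable_continuous_smul hη (hu.inner_const φ)

/-- Continuously differentiable `V`-valued functions vanishing at time `T`. -/
def finalZero (V : Type*) [NormedAddCommGroup V] [NormedSpace ℝ V] (T : ℝ) :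
    Submodule ℝ (ℝ → V) where
  carrier := {φ | ContDiff ℝ 1 φ ∧ φ T = 0}
  zero_mem' := ⟨contDiff_const, rfl⟩
  add_mem' h1 h2 := ⟨h1.1.add h2.1, by simp [h1.2, h2.2]⟩
  smul_mem' c _ h := ⟨contDiff_const.smul h.1, by simp [h.2]⟩

theorem finalZero_differentiable (φ : finalZero V T) (t : ℝ) :
    DifferentiableAt ℝ (φ : ℝ → V) t := φ.2.1.differentiable (by simp) t

theorem finalZero_continuous_deriv (φ : finalZero V T) : Continuous (deriv (φ : ℝ → V)) :=
  φ.2.1.continuous_deriv (by simp)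

theorem finalZero_memLp (φ : finalZero V T) : MemLp (φ : ℝ → V) 2 (timeMeasure T) :=
  memLp_of_continuousOn φ.2.1.continuous.continuousOn 2

theorem finalZero_memLp_op (ι : V →L[ℝ] H) (A : V →L[ℝ] V) (φ : finalZero V T) :
    MemLp (fun t => A (φ.1 t) - gram ι (deriv φ.1 t)) 2 (timeMeasure T) :=
  memLp_of_continuousOn ((A.continuous.comp φ.2.1.continuous).sub
    ((gram ι).continuous.comp (finalZero_continuous_deriv φ))).continuousOn 2

/-- The formal adjoint `φ ↦ -ι* ι φ' + A φ` of the evolution operator. -/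
noncomputable def formalAdjoint (ι : V →L[ℝ] H) (A : V →L[ℝ] V) (T : ℝ) :
    finalZero V T →ₗ[ℝ] Lp V 2 (timeMeasure T) where
  toFun φ := (finalZero_memLp_op ι A φ).toLp _
  map_add' φ ψ := by
    rw [← MemLp.toLp_add]
    refine MemLp.toLp_congr _ _ (Eventually.of_forall fun t => ?_)
    simp only [Submodule.coe_add, Pi.add_apply, map_add,
      deriv_add (finalZero_differentiable φ t) (finalZero_differentiable ψ t)]
    abel
  map_smul' c φ := by
    rw [RingHom.id_apply, ← MemLp.toLp_const_smul]
    refine MemLp.toLp_congr _ _ (Eventually.of_forall fun t => ?_)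
    simp only [Submodule.coe_smul, Pi.smul_apply, map_smul,
      deriv_const_smul c (finalZero_differentiable φ t), smul_sub]

theorem inner_formalAdjoint (A : V →L[ℝ] V) (u : Lp V 2 (timeMeasure T)) (φ : finalZero V T) :
    ⟪u, formalAdjoint ι A T φ⟫_ℝ =
      ∫ t, ⟪u t, A (φ.1 t) - gram ι (deriv φ.1 t)⟫_ℝ ∂timeMeasure T := by
  rw [L2.inner_def]
  refine integral_congr_ae ?_
  filter_upwards [(finalZero_memLp_op ι A φ).coeFn_toLp] with t ht
  simp only [formalAdjoint, LinearMap.coe_mk, AddHom.coe_mk, ht]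

theorem integral_inner_deriv (hT : 0 < T) (φ : finalZero V T) :
    ∫ t, ⟪φ.1 t, gram ι (deriv φ.1 t)⟫_ℝ ∂timeMeasure T = -(1 / 2) * ‖ι (φ.1 0)‖ ^ 2 := by
  have h : ∫ t in (0 : ℝ)..T, (2 * ⟪φ.1 t, gram ι (deriv φ.1 t)⟫_ℝ) =
      ⟪ι (φ.1 T), ι (φ.1 T)⟫_ℝ - ⟪ι (φ.1 0), ι (φ.1 0)⟫_ℝ := by
    refine intervalIntegral.integral_eq_sub_of_hasDerivAt (f := fun t => ⟪ι (φ.1 t), ι (φ.1 t)⟫_ℝ)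
      (fun t _ => ?_) (Continuous.intervalIntegrable ?_ _ _)
    · have h1 := ι.hasFDerivAt.comp_hasDerivAt t (finalZero_differentiable φ t).hasDerivAt
      have h2 := h1.inner ℝ h1
      rw [real_inner_comm _ (ι (deriv φ.1 t)), Function.comp_apply, ← two_mul] at h2
      rw [inner_gram_right]
      exact h2
    · exact continuous_const.mul (φ.2.1.continuous.inner
        ((gram ι).continuous.comp (finalZero_continuous_deriv φ)))
  rw [intervalIntegral_eq_timeMeasure hT.le, integral_const_mul, φ.2.2] at h
  simp only [map_zero, inner_self_eq_norm_sq_to_K] at h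
  simp at h
  linarith

/-- This trajectory vanishes at `T` and equals T φ at 0, so integrating by parts against it isolates
the initial value of a solution. -/
theorem IsWeakTimeDeriv.sub_mul (hT : 0 < T) (φ : V) :
    IsWeakTimeDeriv ι T (fun t => (T - t) • φ) (fun _ => -gram ι φ) where
  memLp_left := memLp_of_continuousOn (by fun_prop) 2
  memLp_right := memLp_const _
  weak η hη ψ := by
    have h := integral_deriv_smul_primitive hT.le T
      (integrable_of_continuous (T := T) (continuous_const (y := (-1 : ℝ)))) hη
    have h1 : primitive T (fun _ => (-1 : ℝ)) = fun t => T - t := by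
      ext t
      simp [primitive, sub_eq_add_neg]
    rw [h1] at h
    simp only [smul_eq_mul] at h
    simp only [map_smul, inner_smul_left, inner_neg_left, inner_gram_left]
    have h2 := congrArg (· * ⟪ι φ, ι ψ⟫_ℝ) h
    simp only [← integral_mul_const, neg_mul] at h2
    simpa [mul_assoc] using h2

theorem IsContinuousRep.sub_mul (φ : V) :
    IsContinuousRep ι T (fun t => (T - t) • φ) (fun t => (T - t) • ι φ) where
  continuousOn := by fun_prop
  ae_eq := Eventually.of_forall fun t => map_smul ι _ _

/-- Weak solvability of `(ι u)' + A u = f`, `u(0) = u₀`. -/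
theorem exists_evolution (hι : Function.Injective ι) (hd : DenseRange ι) (hT : 0 < T)
    {A : V →L[ℝ] V} (hA : ∀ x y, ⟪A x, y⟫_ℝ = ⟪x, A y⟫_ℝ) {c : ℝ} (hc : 0 < c)
    (hco : ∀ x, c * ‖x‖ ^ 2 ≤ ⟪A x, x⟫_ℝ) {f : ℝ → V} (hf : MemLp f 2 (timeMeasure T)) (u₀ : H) :
    ∃ (u : ℝ → V) (U : ℝ → H), IsWeakTimeDeriv ι T u (fun t => f t - A (u t)) ∧
      IsContinuousRep ι T u U ∧ U 0 = u₀ := by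
  have hfφ : ∀ φ : finalZero V T, Integrable (fun t => ⟪f t, φ.1 t⟫_ℝ) (timeMeasure T) :=
    fun φ => integrable_inner_of_memLp hf (finalZero_memLp φ)
  let L : finalZero V T →ₗ[ℝ] ℝ :=
    { toFun := fun φ => ∫ t, ⟪f t, φ.1 t⟫_ℝ ∂timeMeasure T + ⟪u₀, ι (φ.1 0)⟫_ℝ
      map_add' := fun φ ψ => by
        simp only [Submodule.coe_add, Pi.add_apply, inner_add_right, map_add]
        rw [integral_add (hfφ φ) (hfφ ψ)]
        ring
      map_smul' := fun c φ => by
        simp only [Submodule.coe_smul, Pi.smul_apply, inner_smul_right, map_smul,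
          RingHom.id_apply, smul_eq_mul]
        rw [integral_const_mul]
        ring }
  have hbound : ∀ φ, |L φ| ≤
      (‖hf.toLp f‖ / c + ‖u₀‖ * Real.sqrt (2 / c)) * ‖formalAdjoint ι A T φ‖ := by
    intro φ
    set a := ‖(finalZero_memLp φ).toLp _‖
    set b := ‖ι (φ.1 0)‖
    set k := ‖formalAdjoint ι A T φ‖
    have ha : 0 ≤ a := norm_nonneg _
    have hb : 0 ≤ b := norm_nonneg _
    have hk : 0 ≤ k := norm_nonneg _
    have hφφ : ∫ t, ‖φ.1 t‖ ^ 2 ∂timeMeasure T = a ^ 2 := by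
      rw [← real_inner_self_eq_norm_sq, L2.inner_def]
      refine integral_congr_ae ?_
      filter_upwards [(finalZero_memLp φ).coeFn_toLp] with t ht
      rw [ht, real_inner_self_eq_norm_sq]
    -- Pairing φ with its own image under the formal adjoint: coercivity gives the first term, and
    -- -∫⟪φ, G φ'⟫ = ½‖ι φ(0)‖², as φ(T) = 0, gives the second. Both parts of `L` are thereby
    -- bounded by `k`.
    have h1 : c * a ^ 2 + 1 / 2 * b ^ 2 ≤ a * k := by
      refine le_trans ?_ (real_inner_le_norm ((finalZero_memLp φ).toLp _) (formalAdjoint ι A T φ))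
      rw [inner_formalAdjoint]
      have h2 : ∫ t, ⟪(finalZero_memLp φ).toLp _ t, A (φ.1 t) - gram ι (deriv φ.1 t)⟫_ℝ ∂timeMeasure T =
          ∫ t, (⟪φ.1 t, A (φ.1 t)⟫_ℝ - ⟪φ.1 t, gram ι (deriv φ.1 t)⟫_ℝ) ∂timeMeasure T := by
        refine integral_congr_ae ?_
        filter_upwards [(finalZero_memLp φ).coeFn_toLp] with t ht
        rw [ht, inner_sub_right]
      have i1 : Integrable (fun t => ⟪φ.1 t, A (φ.1 t)⟫_ℝ) (timeMeasure T) :=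
        integrable_inner_of_memLp (finalZero_memLp φ) (A.comp_memLp' (finalZero_memLp φ))
      have i2 : Integrable (fun t => ⟪φ.1 t, gram ι (deriv φ.1 t)⟫_ℝ) (timeMeasure T) :=
        integrable_of_continuous (φ.2.1.continuous.inner
          ((gram ι).continuous.comp (finalZero_continuous_deriv φ)))
      rw [h2, integral_sub i1 i2, integral_inner_deriv hT, ← hφφ, ← integral_const_mul]
      have h3 : ∫ t, c * ‖φ.1 t‖ ^ 2 ∂timeMeasure T ≤ ∫ t, ⟪φ.1 t, A (φ.1 t)⟫_ℝ ∂timeMeasure T :=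
        integral_mono ((integrable_norm_sq_of_memLp (finalZero_memLp φ)).const_mul c) i1
          (fun t => by simpa only [real_inner_comm] using hco (φ.1 t))
      linarith
    have h2 : a ≤ k / c := by
      rw [le_div_iff₀ hc]
      by_contra! h3
      nlinarith
    have h3 : b ≤ Real.sqrt (2 / c) * k := by
      refine (pow_le_pow_iff_left₀ hb (by positivity) two_ne_zero).1 ?_
      rw [mul_pow, Real.sq_sqrt (by positivity)]
      have h4 : a * k ≤ k / c * k := mul_le_mul_of_nonneg_right h2 hk
      have h5 : 0 ≤ c * a ^ 2 := by positivity
      calc b ^ 2 ≤ 2 * (k / c * k) := by linarith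
        _ = 2 / c * k ^ 2 := by ring
    have h4 : |∫ t, ⟪f t, φ.1 t⟫_ℝ ∂timeMeasure T| ≤ ‖hf.toLp f‖ * a := by
      refine le_trans (le_of_eq ?_) (abs_real_inner_le_norm (hf.toLp f) ((finalZero_memLp φ).toLp _))
      rw [L2.inner_def]
      congr 1
      refine integral_congr_ae ?_
      filter_upwards [hf.coeFn_toLp, (finalZero_memLp φ).coeFn_toLp] with t h5 h6
      rw [h5, h6]
    calc |L φ| ≤ |∫ t, ⟪f t, φ.1 t⟫_ℝ ∂timeMeasure T| + |⟪u₀, ι (φ.1 0)⟫_ℝ| := abs_add_le _ _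
      _ ≤ ‖hf.toLp f‖ * (k / c) + ‖u₀‖ * (Real.sqrt (2 / c) * k) :=
        add_le_add (h4.trans (mul_le_mul_of_nonneg_left h2 (norm_nonneg _)))
          ((abs_real_inner_le_norm _ _).trans (mul_le_mul_of_nonneg_left h3 (norm_nonneg _)))
      _ = _ := by ring
  obtain ⟨u, hu⟩ := exists_inner_eq_of_abs_le (formalAdjoint ι A T) L hbound
  have hul : MemLp u 2 (timeMeasure T) := Lp.memLp u
  have hui := hul.integrable one_le_two
  have hAu : MemLp (fun t => f t - A (u t)) 2 (timeMeasure T) := hf.sub (A.comp_memLp' hul)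
  -- Testing with η(t) φ. Keeping η(0) arbitrary retains the initial value: compactly supported η
  -- give the equation, and η(t) = T - t then identifies U(0).
  have key : ∀ (η : ℝ → ℝ), ContDiff ℝ 1 η → η T = 0 → ∀ φ : V,
      ∫ t, deriv η t * ⟪ι (u t), ι φ⟫_ℝ ∂timeMeasure T =
        -∫ t, η t * ⟪f t - A (u t), φ⟫_ℝ ∂timeMeasure T - η 0 * ⟪u₀, ι φ⟫_ℝ := by
    intro η hη hηT φ
    have h1 := hu ⟨fun t => η t • φ, hη.smul contDiff_const, by simp [hηT]⟩
    rw [inner_formalAdjoint] at h1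
    have hdη : ∀ t, deriv (fun t => η t • φ) t = deriv η t • φ := fun t =>
      deriv_smul_const (hη.differentiable (by simp) t) φ
    simp only [hdη, L, LinearMap.coe_mk, AddHom.coe_mk, map_smul, inner_sub_right,
      inner_smul_right, ← hA, inner_gram_right] at h1
    have j1 := integrable_mul_inner hη.continuous (A.integrable_comp hui) φ
    have j2 := integrable_mul_inner (hη.continuous_deriv (by simp)) (ι.integrable_comp hui) (ι φ)
    have j3 := integrable_mul_inner hη.continuous (hf.integrable one_le_two) φ
    rw [integral_sub j1 j2] at h1
    simp only [inner_sub_left, mul_sub]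
    rw [integral_sub j3 j1]
    linarith
  have hw : IsWeakTimeDeriv ι T u (fun t => f t - A (u t)) :=
    ⟨hul, hAu, fun η hη φ => by
      rw [key η (hη.contDiff.of_le (by simp)) (hη.eq_zero (by simp)) φ,
        hη.eq_zero (t := 0) (by simp)]
      ring⟩
  obtain ⟨U, hU⟩ := hw.exists_continuousRep hι hT
  refine ⟨u, U, hw, hU, ?_⟩
  have hφ : ∀ φ, ⟪U 0 - u₀, ι φ⟫_ℝ = 0 := by
    intro φ
    have h1 := key (fun t => T - t) (by fun_prop) (by simp) φ
    have h2 := hw.inner_sub_inner hι hT (IsWeakTimeDeriv.sub_mul hT φ) hU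
      (IsContinuousRep.sub_mul φ)
    have hd1 : ∀ t : ℝ, deriv (fun t => T - t) t = -1 := fun t => by simp
    simp only [hd1, sub_self, zero_smul, inner_zero_right, sub_zero, inner_smul_right,
      inner_neg_right, inner_gram_right] at h1 h2
    have j1 := integrable_mul_inner (T := T) (η := fun t => T - t) (by fun_prop)
      (hAu.integrable one_le_two) φ
    have j2 := integrable_mul_inner (T := T) (η := fun _ => -1) continuous_const
      (ι.integrable_comp hui) (ι φ)
    simp only [neg_mul, one_mul] at j2 h1
    rw [integral_add j2 j1] at h2
    rw [inner_sub_left]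
    have h3 : T * (⟪U 0, ι φ⟫_ℝ - ⟪u₀, ι φ⟫_ℝ) = 0 := by linarith
    exact (mul_eq_zero.1 h3).resolve_left hT.ne'
  rw [← sub_eq_zero, ← inner_self_eq_zero (𝕜 := ℝ)]
  exact congrFun (DenseRange.equalizer hd (g := fun x => ⟪U 0 - u₀, x⟫_ℝ) (h := fun _ => 0)
    (by fun_prop) continuous_const (funext hφ)) (U 0 - u₀)

/-- The energy estimate for zero initial values. -/
theorem IsWeakTimeDeriv.energy_le (hι : Function.Injective ι) (hT : 0 < T) {A : V →L[ℝ] V} {c : ℝ}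
    (hc : 0 < c) (hco : ∀ x, c * ‖x‖ ^ 2 ≤ ⟪A x, x⟫_ℝ) {f u w : ℝ → V}
    (hf : MemLp f 2 (timeMeasure T)) (h : IsWeakTimeDeriv ι T u w)
    (hw : ∀ᵐ t ∂timeMeasure T, w t = f t - A (u t)) {U : ℝ → H} (hU : IsContinuousRep ι T u U)
    (h0 : U 0 = 0) :
    c * ‖U T‖ ^ 2 + c ^ 2 * ∫ t, ‖u t‖ ^ 2 ∂timeMeasure T ≤ ∫ t, ‖f t‖ ^ 2 ∂timeMeasure T := by
  have h1 := h.inner_sub_inner hι hT h hU hU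
  rw [h0, inner_zero_left, sub_zero, real_inner_self_eq_norm_sq] at h1
  have i1 := integrable_norm_sq_of_memLp h.memLp_left
  have i2 := integrable_norm_sq_of_memLp hf
  have h2 : c * ‖U T‖ ^ 2 ≤ ∫ t, (‖f t‖ ^ 2 - c ^ 2 * ‖u t‖ ^ 2) ∂timeMeasure T := by
    rw [h1, ← integral_const_mul]
    refine integral_mono_ae (((integrable_inner_of_memLp h.memLp_left h.memLp_right).add
      (integrable_inner_of_memLp h.memLp_right h.memLp_left)).const_mul c)
      (i2.sub (i1.const_mul _)) ?_
    filter_upwards [hw] with t ht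
    have h3 := real_inner_le_norm (f t) (u t)
    have h4 := hco (u t)
    rw [ht, real_inner_comm, ← two_mul, inner_sub_left]
    -- After multiplication by `c`, Young's inequality 2c‖f‖‖u‖ ≤ ‖f‖² + c²‖u‖² uses up half of the
    -- coercive term 2c²‖u‖².
    nlinarith [sq_nonneg (‖f t‖ - c * ‖u t‖)]
  rw [integral_sub i2 (i1.const_mul _), integral_const_mul] at h2
  linarith

end Evolution

/-! ### Sobolev functions on (0,1): primitives, boundary values, Poincaré inequalities, density -/

instance instIsProbabilityMeasureSpaceMeasure : IsProbabilityMeasure spaceMeasure :=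
  ⟨by simp⟩

theorem L2.integrable (f : L2) : Integrable f spaceMeasure :=
  (Lp.memLp f).integrable one_le_two

theorem L2.integral_abs_le (f : L2) : ∫ x, ‖f x‖ ∂spaceMeasure ≤ ‖f‖ := by
  rw [integral_norm_eq_lintegral_enorm (Lp.aestronglyMeasurable f), Lp.norm_def,
    ← eLpNorm_one_eq_lintegral_enorm]
  exact ENNReal.toReal_mono (Lp.eLpNorm_ne_top f)
    (eLpNorm_le_eLpNorm_of_exponent_le one_le_two (Lp.aestronglyMeasurable f))

/-- The increment is at most the L¹ norm of `g`, hence its L² norm on a probability space. As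
`spaceMeasure` unfolds to `timeMeasure 1`, the calculus in time is reused in space with T = 1. -/
theorem abs_primitive_sub_le (c : ℝ) (g : L2) {x y : ℝ} (hx : x ∈ Icc (0 : ℝ) 1)
    (hy : y ∈ Icc (0 : ℝ) 1) : |primitive c g x - primitive c g y| ≤ ‖g‖ := by
  rw [primitive_sub zero_le_one c g.integrable hy hx]
  refine le_trans ?_ g.integral_abs_le
  rw [← intervalIntegral_eq_timeMeasure zero_le_one, ← Real.norm_eq_abs]
  refine intervalIntegral.norm_integral_le_abs_integral_norm.trans ?_
  rw [← abs_of_nonneg (intervalIntegral.integral_nonneg zero_le_one fun s _ => norm_nonneg (g s))]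
  refine intervalIntegral.abs_integral_mono_interval ?_
    (Eventually.of_forall fun s => norm_nonneg (g s))
    (intervalIntegrable_of_integrable zero_le_one g.integrable).norm
  rw [uIoc_of_le zero_le_one]
  rintro s ⟨hs1, hs2⟩
  exact ⟨(le_inf hy.1 hx.1).trans_lt hs1, hs2.trans (sup_le hy.2 hx.2)⟩

theorem memLp_primitive (c : ℝ) (g : L2) : MemLp (primitive c g) 2 spaceMeasure :=
  memLp_of_continuousOn (continuousOn_primitive zero_le_one c g.integrable) 2

theorem primitive_add_fun {g h k : ℝ → ℝ} (hg : Integrable g spaceMeasure)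
    (hh : Integrable h spaceMeasure) (hk : k =ᵐ[spaceMeasure] g + h) {x : ℝ}
    (hx : x ∈ Icc (0 : ℝ) 1) : primitive 0 k x = primitive 0 g x + primitive 0 h x := by
  simp only [primitive, zero_add]
  rw [← intervalIntegral.integral_add (intervalIntegrable_sub zero_le_one hg (by simp) hx)
    (intervalIntegrable_sub zero_le_one hh (by simp) hx)]
  refine intervalIntegral.integral_congr_ae ?_
  filter_upwards [ae_timeMeasure_iff.1 hk] with t ht h1
  exact ht (uIcc_subset_Icc (by simp) hx (uIoc_subset_uIcc h1))

theorem primitive_congr (c : ℝ) {g k : ℝ → ℝ} (hk : k =ᵐ[spaceMeasure] g) {x : ℝ}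
    (hx : x ∈ Icc (0 : ℝ) 1) : primitive c k x = primitive c g x := by
  simp only [primitive]
  congr 1
  refine intervalIntegral.integral_congr_ae ?_
  filter_upwards [ae_timeMeasure_iff.1 hk] with t ht h1
  exact ht (uIcc_subset_Icc (by simp) hx (uIoc_subset_uIcc h1))

theorem ae_mem_Icc : ∀ᵐ x ∂spaceMeasure, x ∈ Icc (0 : ℝ) 1 := by
  filter_upwards [ae_restrict_mem measurableSet_Ioo] with x hx using Ioo_subset_Icc_self hx

/-- The Volterra operator `g ↦ ∫₀ˣ g` on `L²(0,1)`. -/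
noncomputable def volterra : L2 →L[ℝ] L2 :=
  LinearMap.mkContinuous
    { toFun := fun g => (memLp_primitive 0 g).toLp _
      map_add' := fun g h => by
        rw [← MemLp.toLp_add]
        refine MemLp.toLp_congr _ _ ?_
        filter_upwards [ae_mem_Icc] with x hx
        exact primitive_add_fun g.integrable h.integrable (Lp.coeFn_add g h) hx
      map_smul' := fun c g => by
        rw [RingHom.id_apply, ← MemLp.toLp_const_smul]
        refine MemLp.toLp_congr _ _ ?_
        filter_upwards [ae_mem_Icc] with x hx
        rw [primitive_congr 0 (Lp.coeFn_smul c g) hx]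
        simp [primitive] } 1 fun g => by
    have h := Lp.norm_le_of_ae_bound (f := (memLp_primitive 0 g).toLp _) (C := ‖g‖)
      (norm_nonneg g) (by
        filter_upwards [(memLp_primitive 0 g).coeFn_toLp, ae_mem_Icc] with x h1 h2
        have := abs_primitive_sub_le 0 g h2 (left_mem_Icc.2 zero_le_one)
        rwa [primitive_zero, sub_zero, ← Real.norm_eq_abs, ← h1] at this)
    have h1 : (measureUnivNNReal spaceMeasure : ℝ) = 1 := by simp [measureUnivNNReal]
    rwa [h1, Real.one_rpow] at h

theorem volterra_ae (g : L2) : ∀ᵐ x ∂spaceMeasure, volterra g x = primitive 0 g x :=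
  (memLp_primitive 0 g).coeFn_toLp

theorem norm_volterra_le (g : L2) : ‖volterra g‖ ≤ ‖g‖ := by
  have := volterra.le_of_opNorm_le (LinearMap.mkContinuous_norm_le _ zero_le_one _) g
  simpa using this

/-- The constant function `1`. -/
noncomputable def oneL2 : L2 := (memLp_const (1 : ℝ)).toLp _

theorem oneL2_ae : ∀ᵐ x ∂spaceMeasure, oneL2 x = 1 := (memLp_const (1 : ℝ)).coeFn_toLp

theorem inner_oneL2 (g : L2) : ⟪oneL2, g⟫_ℝ = ∫ x, g x ∂spaceMeasure := by
  rw [L2.inner_def]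
  refine integral_congr_ae ?_
  filter_upwards [oneL2_ae] with x hx
  simp [hx]

theorem hasWeakDeriv_of_ae_eq_primitive {f g : L2} {c : ℝ}
    (h : ∀ᵐ x ∂spaceMeasure, f x = primitive c g x) : HasWeakDeriv f g := by
  intro φ hφ
  have h1 := integral_deriv_smul_primitive zero_le_one c g.integrable hφ
  simp only [smul_eq_mul] at h1
  simp only [mul_comm (g _)]
  rw [← h1]
  refine integral_congr_ae ?_
  filter_upwards [h] with x hx
  rw [hx, mul_comm]

theorem HasWeakDeriv.exists_primitive {f g : L2} (h : HasWeakDeriv f g) :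
    ∃ c, ∀ᵐ x ∂spaceMeasure, f x = primitive c g x := by
  refine ae_eq_primitive_of_weakDeriv zero_lt_one f.integrable g.integrable fun η hη => ?_
  simp only [smul_eq_mul, mul_comm (deriv η _), mul_comm (η _)]
  exact h η hη

theorem HasWeakDeriv.unique {f g g' : L2} (h : HasWeakDeriv f g) (h' : HasWeakDeriv f g') :
    g = g' := by
  rw [← sub_eq_zero]
  refine Lp.ext ?_
  have h1 : ∀ᵐ x ∂spaceMeasure, (g - g' : L2) x = 0 := by
    refine ae_eq_zero_of_forall_testFunction (g - g').integrable fun η hη => ?_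
    have h2 : ∫ x, g x * η x ∂spaceMeasure = ∫ x, g' x * η x ∂spaceMeasure :=
      neg_injective ((h η hη).symm.trans (h' η hη))
    rw [integral_mul_eq_inner hη.memLp, integral_mul_eq_inner hη.memLp] at h2
    simp only [smul_eq_mul, mul_comm (η _)]
    rw [integral_mul_eq_inner hη.memLp, inner_sub_right, h2, sub_self]
  filter_upwards [h1, Lp.coeFn_zero ℝ 2 spaceMeasure] with x h2 h3
  rw [h2, h3]; rfl

theorem hasWeakDeriv_volterra (g : L2) : HasWeakDeriv (volterra g) g :=
  hasWeakDeriv_of_ae_eq_primitive (volterra_ae g)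

theorem hasWeakDeriv_oneL2 : HasWeakDeriv oneL2 0 := by
  refine hasWeakDeriv_of_ae_eq_primitive (c := 1) ?_
  filter_upwards [oneL2_ae, ae_mem_Icc] with x hx h
  rw [hx, primitive_congr 1 (Lp.coeFn_zero ℝ 2 spaceMeasure) h]
  simp [primitive]

theorem eq_smul_add_volterra {f g : L2} {c : ℝ} (h : ∀ᵐ x ∂spaceMeasure, f x = primitive c g x) :
    f = c • oneL2 + volterra g := by
  refine Lp.ext ?_
  filter_upwards [h, Lp.coeFn_add (c • oneL2) (volterra g), Lp.coeFn_smul c oneL2, oneL2_ae,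
    volterra_ae g] with x h1 h2 h3 h4 h5
  rw [h1, h2, Pi.add_apply, h3, Pi.smul_apply, h4, h5]
  simp [primitive]

theorem primitive_one (c : ℝ) (g : L2) : primitive c g 1 = c + ⟪oneL2, g⟫_ℝ := by
  rw [inner_oneL2, ← intervalIntegral_eq_timeMeasure zero_le_one, primitive]

/-- The continuous representative is c + ∫₀ˣ g; its values at 0 and 1 are c and c + ∫ g. The
boundary condition thus becomes two continuous linear equations, which give closedness and the
Poincaré inequalities. -/
theorem vanishesOnBoundary_iff {f g : L2} (h : HasWeakDeriv f g) :
    VanishesOnBoundary f ↔ f = volterra g ∧ ⟪oneL2, g⟫_ℝ = 0 := by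
  constructor
  · rintro ⟨F, hF, hfF, h0, h1⟩
    obtain ⟨c, hc⟩ := h.exists_primitive
    have heq : EqOn F (primitive c g) (Icc 0 1) := by
      refine Measure.eqOn_Icc_of_ae_eq volume zero_ne_one ?_ hF
        (continuousOn_primitive zero_le_one c g.integrable)
      rw [Measure.restrict_congr_set Ioo_ae_eq_Icc.symm]
      filter_upwards [hfF, hc] with x h2 h3
      rw [← h2, h3]
    have hc0 : c = 0 := by
      rw [← primitive_zero c g, ← heq (by simp), h0]
    subst hc0
    refine ⟨by simpa using eq_smul_add_volterra hc, ?_⟩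
    have := heq (right_mem_Icc.2 zero_le_one)
    rw [h1, primitive_one, zero_add] at this
    exact this.symm
  · rintro ⟨rfl, h2⟩
    exact ⟨primitive 0 g, continuousOn_primitive zero_le_one 0 g.integrable, volterra_ae g,
      primitive_zero 0 g, by rw [primitive_one, h2, add_zero]⟩

theorem Sobolev.hasWeakDeriv {m : ℕ} (z : Sobolev m) (i : Fin m) :
    HasWeakDeriv (Sobolev.wd i.castSucc z) (Sobolev.wd i.succ z) := z.2 i

theorem Sobolev.inner_eq {m : ℕ} (y z : Sobolev m) :
    ⟪y, z⟫_ℝ = ∑ i, ⟪Sobolev.wd i y, Sobolev.wd i z⟫_ℝ :=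
  PiLp.inner_apply (𝕜 := ℝ) (f := fun _ : Fin (m + 1) => L2) y.1 z.1

theorem Sobolev.norm_sq_eq {m : ℕ} (z : Sobolev m) : ‖z‖ ^ 2 = ∑ i, ‖Sobolev.wd i z‖ ^ 2 := by
  rw [← real_inner_self_eq_norm_sq, Sobolev.inner_eq]
  simp only [real_inner_self_eq_norm_sq]

theorem Sobolev.ext_wd {m : ℕ} {y z : Sobolev m} (h : ∀ i, Sobolev.wd i y = Sobolev.wd i z) :
    y = z := Subtype.ext (PiLp.ext h)

theorem Sobolev.wd_zero_injective {m : ℕ} : Function.Injective (Sobolev.wd (m := m) 0) := by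
  intro y z h
  refine Sobolev.ext_wd fun i => ?_
  induction i using Fin.induction with
  | zero => exact h
  | succ i ih =>
    have h1 := y.hasWeakDeriv i
    rw [ih] at h1
    exact h1.unique (z.hasWeakDeriv i)

theorem ZeroBoundary.inner_eq {m : ℕ} (y z : ZeroBoundary m) :
    ⟪y, z⟫_ℝ = ∑ i, ⟪wd i y, wd i z⟫_ℝ := Sobolev.inner_eq y.1 z.1

theorem ZeroBoundary.norm_sq_eq {m : ℕ} (z : ZeroBoundary m) : ‖z‖ ^ 2 = ∑ i, ‖wd i z‖ ^ 2 :=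
  Sobolev.norm_sq_eq z.1

theorem wd_zero_injective {m : ℕ} : Function.Injective (wd (m := m) 0) := fun _ _ h =>
  Subtype.ext (Sobolev.wd_zero_injective h)

theorem isClosed_zeroBoundarySubmodule (m : ℕ) :
    IsClosed (zeroBoundarySubmodule (m + 1) : Set (Sobolev (m + 1))) := by
  have : (zeroBoundarySubmodule (m + 1) : Set (Sobolev (m + 1))) =
      {z | Sobolev.wd 0 z = volterra (Sobolev.wd 1 z)} ∩ {z | ⟪oneL2, Sobolev.wd 1 z⟫_ℝ = 0} := by
    ext z
    exact vanishesOnBoundary_iff (z.hasWeakDeriv 0)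
  rw [this]
  exact (isClosed_eq (by fun_prop) (by fun_prop)).inter (isClosed_eq (by fun_prop) (by fun_prop))

instance instCompleteSpaceH10 : CompleteSpace H10 :=
  (isClosed_zeroBoundarySubmodule 0).completeSpace_coe

instance instCompleteSpaceV02 : CompleteSpace V02 :=
  (isClosed_zeroBoundarySubmodule 1).completeSpace_coe

/-- Poincaré: a function vanishing at 0 is the Volterra integral of its derivative, and that
operator is a contraction. -/
theorem norm_wd_zero_le {m : ℕ} (z : ZeroBoundary (m + 1)) :
    ‖wd 0 z‖ ≤ ‖wd (1 : Fin (m + 2)) z‖ := by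
  have h := ((vanishesOnBoundary_iff (z.1.hasWeakDeriv 0)).1 z.2).1
  calc ‖wd 0 z‖ = ‖volterra (wd (1 : Fin (m + 2)) z)‖ := congrArg norm h
    _ ≤ _ := norm_volterra_le _

theorem H10.norm_sq_le (z : H10) : ‖z‖ ^ 2 ≤ 2 * ‖wd 1 z‖ ^ 2 := by
  rw [ZeroBoundary.norm_sq_eq, Fin.sum_univ_two]
  have := pow_le_pow_left₀ (norm_nonneg _) (norm_wd_zero_le z) 2
  linarith

/-- The derivative z' has mean zero because z vanishes at both ends. In z' = c + ∫₀ˣ z'' the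
constant is therefore orthogonal to z', and ‖z'‖² is the inner product of ∫₀ˣ z'' with z'. -/
theorem V02.norm_wd_one_le (z : V02) : ‖wd 1 z‖ ≤ ‖wd 2 z‖ := by
  have h1 := ((vanishesOnBoundary_iff (z.1.hasWeakDeriv 0)).1 z.2).2
  obtain ⟨c, hc⟩ := (z.1.hasWeakDeriv 1).exists_primitive
  have h2 : wd 1 z = c • oneL2 + volterra (wd 2 z) := eq_smul_add_volterra hc
  have h3 : ⟪oneL2, wd 1 z⟫_ℝ = 0 := h1
  have h4 : ‖wd 1 z‖ ^ 2 ≤ ‖wd 2 z‖ * ‖wd 1 z‖ := by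
    rw [← real_inner_self_eq_norm_sq]
    nth_rw 1 [h2]
    rw [inner_add_left, inner_smul_left, h3, mul_zero, zero_add]
    exact (real_inner_le_norm _ _).trans (mul_le_mul_of_nonneg_right (norm_volterra_le _)
      (norm_nonneg _))
  by_contra! h5
  nlinarith [norm_nonneg (wd 2 z)]

theorem V02.norm_sq_le (z : V02) : ‖z‖ ^ 2 ≤ 3 * ‖wd 2 z‖ ^ 2 := by
  rw [ZeroBoundary.norm_sq_eq, Fin.sum_univ_three]
  have h1 := pow_le_pow_left₀ (norm_nonneg _) (norm_wd_zero_le z) 2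
  have h2 := pow_le_pow_left₀ (norm_nonneg _) z.norm_wd_one_le 2
  have h3 : ‖wd (m := 1 + 1) 1 z‖ = ‖wd (m := 2) 1 z‖ := rfl
  linarith

/-- The element of `H¹(0,1)` with a given weak derivative. -/
noncomputable def Sobolev.mkOne {f g : L2} (h : HasWeakDeriv f g) : Sobolev 1 :=
  (⟨WithLp.toLp 2 ![f, g], fun i => by fin_cases i; exact h⟩ : ↥(sobolevSubmodule 1))

theorem Sobolev.wd_zero_mkOne {f g : L2} (h : HasWeakDeriv f g) :
    Sobolev.wd 0 (Sobolev.mkOne h) = f := rfl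

theorem Sobolev.wd_one_mkOne {f g : L2} (h : HasWeakDeriv f g) :
    Sobolev.wd 1 (Sobolev.mkOne h) = g := rfl

/-- The element of `V₀²` with given weak derivatives. -/
noncomputable def V02.mk {f g k : L2} (h : HasWeakDeriv f g) (h' : HasWeakDeriv g k)
    (hb : VanishesOnBoundary f) : V02 :=
  (⟨(⟨WithLp.toLp 2 ![f, g, k], fun i => by fin_cases i; exacts [h, h']⟩ :
    ↥(sobolevSubmodule 2)), hb⟩ : ↥(zeroBoundarySubmodule 2))

theorem V02.wd_zero_toH10 (z : V02) : wd 0 z.toH10 = wd 0 z := rfl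

theorem IsTestFunction.deriv {a b : ℝ} {φ : ℝ → ℝ} (h : IsTestFunction a b φ) :
    IsTestFunction a b (deriv φ) :=
  ⟨(contDiff_infty_iff_deriv.1 h.contDiff).2, h.hasCompactSupport.deriv,
    (tsupport_deriv_subset).trans h.tsupport_subset⟩

theorem IsTestFunction.hasWeakDeriv {φ : ℝ → ℝ} (h : IsTestFunction 0 1 φ) :
    HasWeakDeriv (h.memLp.toLp _) (h.memLp_deriv.toLp _) := by
  refine hasWeakDeriv_of_ae_eq_primitive (c := 0) ?_
  filter_upwards [h.memLp.coeFn_toLp, ae_mem_Icc] with x h1 h2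
  rw [h1, primitive_congr 0 h.memLp_deriv.coeFn_toLp h2]
  exact congrFun h.eq_primitive x

theorem IsTestFunction.vanishesOnBoundary {φ : ℝ → ℝ} (h : IsTestFunction 0 1 φ) :
    VanishesOnBoundary (h.memLp.toLp _) :=
  ⟨φ, h.continuous.continuousOn, h.memLp.coeFn_toLp, h.eq_zero (by simp), h.eq_zero (by simp)⟩

/-- A test function as an element of `V₀²`. -/
noncomputable def IsTestFunction.toV02 {φ : ℝ → ℝ} (h : IsTestFunction 0 1 φ) : V02 :=
  V02.mk h.hasWeakDeriv h.deriv.hasWeakDeriv h.vanishesOnBoundary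

/-- `V₀²` is dense in `H¹₀`. -/
theorem H10.eq_zero_of_inner_toH10 {y : H10} (h : ∀ φ : V02, ⟪y, φ.toH10⟫_ℝ = 0) : y = 0 := by
  -- Orthogonality to test functions says y'' = y weakly. Hence y itself belongs to V₀² and may be
  -- tested against itself.
  have h1 : HasWeakDeriv (wd 1 y) (wd 0 y) := by
    rw [hasWeakDeriv_iff]
    intro φ hφ
    have h2 := h hφ.toV02
    rw [ZeroBoundary.inner_eq, Fin.sum_univ_two] at h2
    rw [real_inner_comm, real_inner_comm (wd 0 y)]
    exact eq_neg_of_add_eq_zero_right h2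
  have h2 := h (V02.mk (y.1.hasWeakDeriv 0) h1 y.2)
  have h3 : (V02.mk (y.1.hasWeakDeriv 0) h1 y.2).toH10 = y := wd_zero_injective rfl
  rw [h3] at h2
  exact inner_self_eq_zero.1 h2

theorem V02.denseRange_wd : DenseRange (wd 0 : V02 →L[ℝ] L2) := by
  have h : (LinearMap.range ((wd 0 : V02 →L[ℝ] L2) : V02 →ₗ[ℝ] L2)).topologicalClosure = ⊤ := by
    rw [Submodule.topologicalClosure_eq_top_iff, Submodule.eq_bot_iff]
    intro f hf
    refine Lp.ext ?_
    have h1 : ∀ᵐ x ∂spaceMeasure, f x = 0 := by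
      refine ae_eq_zero_of_forall_testFunction f.integrable fun η hη => ?_
      have h2 := (Submodule.mem_orthogonal _ _).1 hf (wd 0 hη.toV02) ⟨hη.toV02, rfl⟩
      simp only [smul_eq_mul, mul_comm (η _)]
      rw [integral_mul_eq_inner hη.memLp]
      exact h2
    filter_upwards [h1, Lp.coeFn_zero ℝ 2 spaceMeasure] with x h2 h3
    rw [h2, h3]; rfl
  intro x
  have : x ∈ ((LinearMap.range ((wd 0 : V02 →L[ℝ] L2) : V02 →ₗ[ℝ] L2)).topologicalClosure :
      Set L2) := by
    rw [h]; trivial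
  rwa [Submodule.topologicalClosure_coe, LinearMap.coe_range] at this

theorem H10.denseRange_wd : DenseRange (wd 0 : H10 →L[ℝ] L2) :=
  V02.denseRange_wd.mono (by rintro _ ⟨z, rfl⟩; exact ⟨V02.toH10 z, rfl⟩)

theorem Sobolev.norm_wd_le {m : ℕ} (z : Sobolev m) (i : Fin (m + 1)) : ‖Sobolev.wd i z‖ ≤ ‖z‖ := by
  refine (pow_le_pow_iff_left₀ (norm_nonneg _) (norm_nonneg _) two_ne_zero).1 ?_
  rw [Sobolev.norm_sq_eq]
  exact Finset.single_le_sum (f := fun i => ‖Sobolev.wd i z‖ ^ 2) (fun _ _ => by positivity)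
    (Finset.mem_univ i)

theorem norm_wd_le {m : ℕ} (z : ZeroBoundary m) (i : Fin (m + 1)) : ‖wd i z‖ ≤ ‖z‖ :=
  Sobolev.norm_wd_le z.1 i

/-! ### Multiplication by H¹ coefficients and the elliptic operators -/

/-- The embedding `H¹(0,1) ⊆ L^∞(0,1)`. -/
theorem Sobolev.ae_abs_le (d : Sobolev 1) : ∀ᵐ x ∂spaceMeasure, ‖Sobolev.wd 0 d x‖ ≤ 2 * ‖d‖ := by
  obtain ⟨c, hc⟩ := (d.hasWeakDeriv 0).exists_primitive
  set f := Sobolev.wd 0 d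
  set g : L2 := Sobolev.wd 1 d
  have hfd : ‖f‖ ≤ ‖d‖ := d.norm_wd_le 0
  have hgd : ‖g‖ ≤ ‖d‖ := d.norm_wd_le 1
  filter_upwards [hc, ae_mem_Icc] with x hx h1
  -- Averaging |f(x)| ≤ |f(y)| + ‖g‖ over y gives |f(x)| ≤ ‖f‖ + ‖g‖, whence the constant 2.
  have h2 : ∫ _y, ‖f x‖ ∂spaceMeasure ≤ ∫ y, (‖f y‖ + ‖g‖) ∂spaceMeasure := by
    refine integral_mono_ae (integrable_const _) (f.integrable.norm.add (integrable_const _)) ?_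
    filter_upwards [hc, ae_mem_Icc] with y hy h3
    have h4 := abs_primitive_sub_le c g h1 h3
    have h5 : primitive c g x = f x := hx.symm
    have h6 : primitive c g y = f y := hy.symm
    rw [h5, h6] at h4
    have := norm_sub_norm_le (f x) (f y)
    rw [← Real.norm_eq_abs] at h4
    linarith
  rw [integral_add f.integrable.norm (integrable_const _)] at h2
  simp only [integral_const, probReal_univ, one_smul] at h2
  linarith [f.integral_abs_le]

theorem Sobolev.memLp_top (d : Sobolev 1) : MemLp (Sobolev.wd 0 d) ⊤ spaceMeasure :=
  memLp_top_of_bound (Lp.aestronglyMeasurable _) _ d.ae_abs_le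

/-- The embedding `H¹(0,1) → L^∞(0,1)`. -/
noncomputable def Sobolev.toLinfty : Sobolev 1 →L[ℝ] Lp ℝ ⊤ spaceMeasure :=
  LinearMap.mkContinuous
    { toFun := fun d => d.memLp_top.toLp _
      map_add' := fun d e => by
        rw [← MemLp.toLp_add]
        refine MemLp.toLp_congr _ _ ?_
        rw [map_add]
        exact Lp.coeFn_add _ _
      map_smul' := fun c d => by
        rw [RingHom.id_apply, ← MemLp.toLp_const_smul]
        refine MemLp.toLp_congr _ _ ?_
        rw [map_smul]
        exact Lp.coeFn_smul _ _ } 2 fun d => by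
    refine Lp.norm_le_of_ae_bound (f := d.memLp_top.toLp _) (C := 2 * ‖d‖) (by positivity) ?_ |>.trans
      (le_of_eq (by simp))
    filter_upwards [d.memLp_top.coeFn_toLp, d.ae_abs_le] with x h1 h2
    rwa [h1]

theorem Sobolev.toLinfty_ae (d : Sobolev 1) :
    ∀ᵐ x ∂spaceMeasure, Sobolev.toLinfty d x = Sobolev.wd 0 d x := d.memLp_top.coeFn_toLp

theorem Sobolev.norm_toLinfty_le (d : Sobolev 1) : ‖Sobolev.toLinfty d‖ ≤ 2 * ‖d‖ :=
  Sobolev.toLinfty.le_of_opNorm_le (LinearMap.mkContinuous_norm_le _ zero_le_two _) d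

/-- Multiplication of `L²(0,1)` by a function in `H¹(0,1)`. -/
noncomputable def mulL : Sobolev 1 →L[ℝ] L2 →L[ℝ] L2 :=
  ((ContinuousLinearMap.mul ℝ ℝ).holderL spaceMeasure ⊤ 2 2).comp Sobolev.toLinfty

theorem mulL_ae (d : Sobolev 1) (g : L2) :
    ∀ᵐ x ∂spaceMeasure, mulL d g x = Sobolev.wd 0 d x * g x := by
  filter_upwards [(ContinuousLinearMap.mul ℝ ℝ).coeFn_holder (r := 2) (Sobolev.toLinfty d) g,
    d.toLinfty_ae] with x h1 h2
  rw [← h2]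
  exact h1

theorem norm_mulL_le (d : Sobolev 1) (g : L2) : ‖mulL d g‖ ≤ 2 * ‖d‖ * ‖g‖ := by
  have h := ContinuousLinearMap.norm_holder_apply_apply_le (r := 2) (ContinuousLinearMap.mul ℝ ℝ)
    (Sobolev.toLinfty d) g
  refine le_trans h ?_
  have h1 : ‖ContinuousLinearMap.mul ℝ ℝ‖ ≤ 1 := ContinuousLinearMap.opNorm_mul_le ℝ ℝ
  calc ‖ContinuousLinearMap.mul ℝ ℝ‖ * ‖Sobolev.toLinfty d‖ * ‖g‖ ≤ 1 * (2 * ‖d‖) * ‖g‖ := by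
        gcongr
        exact d.norm_toLinfty_le
    _ = _ := by ring

theorem inner_mulL (d : Sobolev 1) (f g : L2) :
    ⟪mulL d f, g⟫_ℝ = ∫ x, Sobolev.wd 0 d x * f x * g x ∂spaceMeasure := by
  rw [L2.inner_def]
  refine integral_congr_ae ?_
  filter_upwards [mulL_ae d f] with x hx
  rw [hx]
  simp [mul_comm]

theorem inner_mulL_comm (d : Sobolev 1) (f g : L2) : ⟪mulL d f, g⟫_ℝ = ⟪f, mulL d g⟫_ℝ := by
  rw [real_inner_comm _ f, inner_mulL, inner_mulL]
  exact integral_congr_ae (Eventually.of_forall fun x => by ring)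

theorem le_inner_mulL {d : Sobolev 1} {a : ℝ} (h : ∀ᵐ x ∂spaceMeasure, a ≤ Sobolev.wd 0 d x)
    (g : L2) : a * ‖g‖ ^ 2 ≤ ⟪mulL d g, g⟫_ℝ := by
  rw [← real_inner_self_eq_norm_sq, L2.inner_def, inner_mulL, ← integral_const_mul]
  refine integral_mono_ae ((L2.integrable_inner g g).const_mul a) ?_ ?_
  · refine (L2.integrable_inner (mulL d g) g).congr ?_
    filter_upwards [mulL_ae d g] with x hx
    rw [hx]
    simp [mul_comm]
  · filter_upwards [h] with x hx
    simp only [real_inner_self_eq_norm_sq, Real.norm_eq_abs, sq_abs]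
    nlinarith [mul_le_mul_of_nonneg_right hx (sq_nonneg (g x))]

/-- The operator representing the form `(M (j x), j y)`. -/
noncomputable def pullbackOp {V H : Type*} [NormedAddCommGroup V] [InnerProductSpace ℝ V]
    [CompleteSpace V] [NormedAddCommGroup H] [InnerProductSpace ℝ H] [CompleteSpace H]
    (j : V →L[ℝ] H) (M : H →L[ℝ] H) : V →L[ℝ] V :=
  ((ContinuousLinearMap.adjoint j).comp M).comp j

theorem inner_pullbackOp {V H : Type*} [NormedAddCommGroup V] [InnerProductSpace ℝ V]
    [CompleteSpace V] [NormedAddCommGroup H] [InnerProductSpace ℝ H] [CompleteSpace H]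
    (j : V →L[ℝ] H) (M : H →L[ℝ] H) (x y : V) : ⟪pullbackOp j M x, y⟫_ℝ = ⟪M (j x), j y⟫_ℝ := by
  simp [pullbackOp, ContinuousLinearMap.adjoint_inner_left]

/-- The operator on `H¹₀(0,1)` representing the diffusion form. -/
noncomputable def diffusionOp (d : Sobolev 1) : H10 →L[ℝ] H10 := pullbackOp (wd 1) (mulL d)

theorem inner_diffusionOp' (d : Sobolev 1) (v φ : H10) :
    ⟪diffusionOp d v, φ⟫_ℝ = ⟪mulL d (wd 1 v), wd 1 φ⟫_ℝ := inner_pullbackOp _ _ _ _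

theorem inner_diffusionOp (d : Sobolev 1) (v φ : H10) :
    ⟪diffusionOp d v, φ⟫_ℝ = diffusionForm d v φ := by
  rw [inner_diffusionOp', inner_mulL, diffusionForm]

theorem diffusionOp_symm (d : Sobolev 1) (v φ : H10) :
    ⟪diffusionOp d v, φ⟫_ℝ = ⟪v, diffusionOp d φ⟫_ℝ := by
  rw [real_inner_comm _ v, inner_diffusionOp', inner_diffusionOp', inner_mulL_comm, real_inner_comm]

theorem diffusionOp_coercive {d : Sobolev 1} {a : ℝ} (ha : 0 ≤ a)
    (h : ∀ᵐ x ∂spaceMeasure, a ≤ Sobolev.wd 0 d x) (v : H10) :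
    a / 2 * ‖v‖ ^ 2 ≤ ⟪diffusionOp d v, v⟫_ℝ := by
  rw [inner_diffusionOp']
  refine le_trans ?_ (le_inner_mulL h _)
  have := mul_le_mul_of_nonneg_left v.norm_sq_le ha
  linarith

/-- The operator on `V₀²` representing `(u_xx, φ_xx)`. -/
noncomputable def bilaplacian : V02 →L[ℝ] V02 := gram (wd 2)

theorem bilaplacian_symm (u φ : V02) : ⟪bilaplacian u, φ⟫_ℝ = ⟪u, bilaplacian φ⟫_ℝ := by
  rw [bilaplacian, inner_gram_left, inner_gram_right]

theorem bilaplacian_coercive (u : V02) : 1 / 3 * ‖u‖ ^ 2 ≤ ⟪bilaplacian u, u⟫_ℝ := by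
  rw [bilaplacian, inner_gram_left, real_inner_self_eq_norm_sq]
  linarith [u.norm_sq_le]

/-! ### Neumann problem -/

/-- Integration of an `L¹` function against a function in `H¹(0,1)`. -/
noncomputable def pairing (δ : Sobolev 1) : Lp ℝ 1 spaceMeasure →L[ℝ] ℝ :=
  (ContinuousLinearMap.mul ℝ ℝ).lpPairing spaceMeasure ⊤ 1 (Sobolev.toLinfty δ)

theorem pairing_eq (δ : Sobolev 1) (r : Lp ℝ 1 spaceMeasure) :
    pairing δ r = ∫ x, Sobolev.wd 0 δ x * r x ∂spaceMeasure := by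
  rw [pairing, ContinuousLinearMap.lpPairing_eq_integral]
  refine integral_congr_ae ?_
  filter_upwards [δ.toLinfty_ae] with x hx
  simp [hx]

theorem Lp_one_integrable (r : Lp ℝ 1 spaceMeasure) : Integrable r spaceMeasure :=
  memLp_one_iff_integrable.1 (Lp.memLp r)

theorem integrable_wd_mul (δ : Sobolev 1) {r : ℝ → ℝ} (hr : Integrable r spaceMeasure) :
    Integrable (fun x => Sobolev.wd 0 δ x * r x) spaceMeasure :=
  hr.bdd_mul (Lp.aestronglyMeasurable _) δ.ae_abs_le

/-- Integrating (G δ)' over (0,1), with G the representative of Λ', gives zero because G vanishes at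
both ends. Substituting G' = Λ + r yields the weak form. -/
theorem IsNeumannSolution.inner_eq {r : Lp ℝ 1 spaceMeasure} {Λ : Sobolev 1}
    (h : IsNeumannSolution r Λ) (δ : Sobolev 1) : ⟪Λ, δ⟫_ℝ = -pairing δ r := by
  obtain ⟨G, hG, hΛ, hd, h0, h1⟩ := h
  obtain ⟨c, hc⟩ := (δ.hasWeakDeriv 0).exists_primitive
  set δ1 : L2 := Sobolev.wd 1 δ
  have hD := ae_hasDerivAt_primitive zero_le_one c δ1.integrable
  have hi := hG.integral_deriv_mul_eq_sub
    (absolutelyContinuous_primitive_real zero_le_one c δ1.integrable)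
  rw [h0, h1, zero_mul, zero_mul, sub_zero, intervalIntegral_eq_timeMeasure zero_le_one] at hi
  rw [Sobolev.inner_eq, Fin.sum_univ_two, L2.inner_def, L2.inner_def, pairing_eq,
    eq_neg_iff_add_eq_zero, ← hi, ← integral_add (L2.integrable_inner _ _)
    (L2.integrable_inner _ _), ← integral_add ((L2.integrable_inner _ _).fun_add
    (L2.integrable_inner _ _)) (integrable_wd_mul δ (Lp_one_integrable r))]
  refine integral_congr_ae ?_
  filter_upwards [hc, hΛ, hd, ae_timeMeasure_iff.2 hD] with x g1 g2 g3 g4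
  have g5 : Sobolev.wd 0 δ x = primitive c δ1 x := g1
  have g6 : deriv G x = r x + Sobolev.wd 0 Λ x := by linarith [g3.2]
  simp only [g4.deriv, g6, ← g5, g2, real_inner_eq_re_inner]
  simp [δ1]
  ring

theorem exists_isNeumannSolution (r : Lp ℝ 1 spaceMeasure) : ∃ Λ, IsNeumannSolution r Λ := by
  let ℓ : StrongDual ℝ (Sobolev 1) :=
    -((((ContinuousLinearMap.mul ℝ ℝ).lpPairing spaceMeasure ⊤ 1).flip r).comp Sobolev.toLinfty)
  set Λ := (InnerProductSpace.toDual ℝ (Sobolev 1)).symm ℓ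
  have hΛ : ∀ δ, ⟪Λ, δ⟫_ℝ = -pairing δ r := fun δ => InnerProductSpace.toDual_symm_apply
  set f : L2 := Sobolev.wd 0 Λ
  have hg : Integrable (fun x => f x + r x) spaceMeasure := f.integrable.add (Lp_one_integrable r)
  set G := primitive 0 (fun x => f x + r x)
  -- The Neumann condition at 1 is natural: it is the weak form tested with the constant 1.
  have hG1 : G 1 = 0 := by
    have h1 := hΛ (Sobolev.mkOne hasWeakDeriv_oneL2)
    rw [Sobolev.inner_eq, Fin.sum_univ_two, Sobolev.wd_zero_mkOne, Sobolev.wd_one_mkOne,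
      inner_zero_right, add_zero, real_inner_comm, inner_oneL2, pairing_eq,
      Sobolev.wd_zero_mkOne] at h1
    have h2 : ∫ x, oneL2 x * r x ∂spaceMeasure = ∫ x, r x ∂spaceMeasure := by
      refine integral_congr_ae ?_
      filter_upwards [oneL2_ae] with x hx
      rw [hx, one_mul]
    have h3 : G 1 = ∫ x, (f x + r x) ∂spaceMeasure := by
      simp only [G, primitive, zero_add]
      exact intervalIntegral_eq_timeMeasure zero_le_one _
    rw [h3, integral_add f.integrable (Lp_one_integrable r), ← h2]
    change ∫ x, f x ∂spaceMeasure = _ at h1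
    rw [h1, neg_add_cancel]
  have hGm : MemLp G 2 spaceMeasure :=
    memLp_of_continuousOn (continuousOn_primitive zero_le_one 0 hg) 2
  -- The weak form tested with ∫₀ˣ h, whose derivative `h` is an arbitrary L² function, followed by
  -- integration by parts; this identifies Λ' with `G`.
  have key : ∀ h : L2, ⟪Sobolev.wd 1 Λ - hGm.toLp G, h⟫_ℝ = 0 := by
    intro h
    have h1 := hΛ (Sobolev.mkOne (hasWeakDeriv_volterra h))
    rw [Sobolev.inner_eq, Fin.sum_univ_two, Sobolev.wd_zero_mkOne, Sobolev.wd_one_mkOne,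
      pairing_eq, Sobolev.wd_zero_mkOne] at h1
    have h2 := bilinear_primitive_sub (ContinuousLinearMap.mul ℝ ℝ) zero_le_one (0 : ℝ) (0 : ℝ)
      hg h.integrable (left_mem_Icc.2 zero_le_one) (right_mem_Icc.2 zero_le_one)
    rw [intervalIntegral_eq_timeMeasure zero_le_one] at h2
    simp only [ContinuousLinearMap.mul_apply', primitive_zero, zero_mul, sub_zero] at h2
    change ∫ t, G t * h t + (f t + r t) * primitive 0 h t ∂spaceMeasure = G 1 * _ at h2
    rw [hG1, zero_mul] at h2
    have h3 : ⟪hGm.toLp G, h⟫_ℝ + (⟪f, volterra h⟫_ℝ +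
        ∫ x, volterra h x * r x ∂spaceMeasure) = 0 := by
      have i3 : Integrable (fun x => volterra h x * r x) spaceMeasure :=
        integrable_wd_mul (Sobolev.mkOne (hasWeakDeriv_volterra h)) (Lp_one_integrable r)
      rw [L2.inner_def, L2.inner_def, ← integral_add (L2.integrable_inner _ _) i3,
        ← integral_add (L2.integrable_inner _ _) ((L2.integrable_inner _ _).fun_add i3), ← h2]
      refine integral_congr_ae ?_
      filter_upwards [hGm.coeFn_toLp, volterra_ae h] with x g1 g2
      rw [g1, g2]
      simp
      ring
    rw [inner_sub_left]
    linarith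
  refine ⟨Λ, G, absolutelyContinuous_primitive_real zero_le_one 0 hg, ?_, ?_, primitive_zero _ _,
    hG1⟩
  · have h1 := sub_eq_zero.1 (inner_self_eq_zero.1 (key _))
    rw [h1]
    exact hGm.coeFn_toLp
  · filter_upwards [ae_timeMeasure_iff.2 (ae_hasDerivAt_primitive zero_le_one 0 hg)] with x hx
    exact ⟨hx.differentiableAt, by rw [hx.deriv]; ring⟩

/-! ### Differences of solutions, time reversal and the backward problem -/

section Evolution

variable {V H : Type*} [NormedAddCommGroup V] [InnerProductSpace ℝ V] [CompleteSpace V]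
  [NormedAddCommGroup H] [InnerProductSpace ℝ H] [CompleteSpace H]
variable {ι : V →L[ℝ] H} {T : ℝ}

theorem IsWeakTimeDeriv.sub {u w p z : ℝ → V} (hu : IsWeakTimeDeriv ι T u w)
    (hp : IsWeakTimeDeriv ι T p z) :
    IsWeakTimeDeriv ι T (fun t => u t - p t) (fun t => w t - z t) where
  memLp_left := hu.memLp_left.sub hp.memLp_left
  memLp_right := hu.memLp_right.sub hp.memLp_right
  weak η hη φ := by
    simp only [map_sub, inner_sub_left, mul_sub]
    rw [integral_sub
      (integrable_mul_inner hη.continuous_deriv (ι.integrable_comp hu.integrable_left) _)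
      (integrable_mul_inner hη.continuous_deriv (ι.integrable_comp hp.integrable_left) _),
      integral_sub (integrable_mul_inner hη.continuous hu.integrable_right _)
      (integrable_mul_inner hη.continuous hp.integrable_right _), hu.weak η hη, hp.weak η hη]
    ring

theorem IsContinuousRep.sub {u p : ℝ → V} {U P : ℝ → H} (hu : IsContinuousRep ι T u U)
    (hp : IsContinuousRep ι T p P) :
    IsContinuousRep ι T (fun t => u t - p t) (fun t => U t - P t) where
  continuousOn := hu.continuousOn.sub hp.continuousOn
  ae_eq := by
    filter_upwards [hu.ae_eq, hp.ae_eq] with t h1 h2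
    rw [map_sub, h1, h2]

theorem measurePreserving_reverse (T : ℝ) :
    MeasurePreserving (fun t => T - t) (timeMeasure T) (timeMeasure T) := by
  have h := (Measure.measurePreserving_sub_left (volume : Measure ℝ) T).restrict_preimage
    (measurableSet_Ioo (a := 0) (b := T))
  simpa using h

theorem integral_reverse (T : ℝ) (f : ℝ → ℝ) :
    ∫ t, f (T - t) ∂timeMeasure T = ∫ t, f t ∂timeMeasure T :=
  (measurePreserving_reverse T).integral_comp
    (MeasurableEquiv.subLeft T).measurableEmbedding f

theorem ae_reverse {p : ℝ → Prop} (h : ∀ᵐ t ∂timeMeasure T, p t) :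
    ∀ᵐ t ∂timeMeasure T, p (T - t) :=
  (measurePreserving_reverse T).quasiMeasurePreserving.ae h

theorem IsTestFunction.reverse {η : ℝ → ℝ} (h : IsTestFunction 0 T η) :
    IsTestFunction 0 T (fun t => η (T - t)) where
  contDiff := h.contDiff.comp (contDiff_const.sub contDiff_id)
  hasCompactSupport := h.hasCompactSupport.comp_homeomorph (Homeomorph.subLeft T)
  tsupport_subset := by
    have h1 : tsupport (fun t => η (T - t)) = (fun t => T - t) ⁻¹' tsupport η :=
      tsupport_comp_eq_preimage η (Homeomorph.subLeft T)
    rw [h1]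
    intro t ht
    have := h.tsupport_subset ht
    exact ⟨by linarith [this.2], by linarith [this.1]⟩

theorem IsWeakTimeDeriv.reverse {u w : ℝ → V} (h : IsWeakTimeDeriv ι T u w) :
    IsWeakTimeDeriv ι T (fun t => u (T - t)) (fun t => -w (T - t)) where
  memLp_left := h.memLp_left.comp_measurePreserving (measurePreserving_reverse T)
  memLp_right := (h.memLp_right.comp_measurePreserving (measurePreserving_reverse T)).neg
  weak η hη φ := by
    have h1 := h.weak _ hη.reverse φ
    rw [← integral_reverse T, ← integral_reverse T (fun t => η (T - t) * _)] at h1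
    have hd : ∀ t, deriv (fun t => η (T - t)) t = -deriv η (T - t) := fun _ =>
      deriv_comp_const_sub _ _ _
    simp only [hd, sub_sub_cancel, neg_mul] at h1
    simp only [inner_neg_left, mul_neg]
    rw [integral_neg] at h1 ⊢
    linarith

theorem IsContinuousRep.reverse {u : ℝ → V} {U : ℝ → H} (h : IsContinuousRep ι T u U) :
    IsContinuousRep ι T (fun t => u (T - t)) (fun t => U (T - t)) where
  continuousOn := h.continuousOn.comp (by fun_prop) fun t ht =>
    ⟨by linarith [ht.2], by linarith [ht.1]⟩
  ae_eq := ae_reverse h.ae_eq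

/-- Solvability of the backward problem `-(ι u)' + A u = f`, `u(T) = u₁`. -/
theorem exists_backward_evolution (hι : Function.Injective ι) (hd : DenseRange ι) (hT : 0 < T)
    {A : V →L[ℝ] V} (hA : ∀ x y, ⟪A x, y⟫_ℝ = ⟪x, A y⟫_ℝ) {c : ℝ} (hc : 0 < c)
    (hco : ∀ x, c * ‖x‖ ^ 2 ≤ ⟪A x, x⟫_ℝ) {f : ℝ → V} (hf : MemLp f 2 (timeMeasure T)) (u₁ : H) :
    ∃ (u : ℝ → V) (U : ℝ → H), IsWeakTimeDeriv ι T u (fun t => A (u t) - f t) ∧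
      IsContinuousRep ι T u U ∧ U T = u₁ := by
  obtain ⟨u, U, h1, h2, h3⟩ := exists_evolution hι hd hT hA hc hco
    (hf.comp_measurePreserving (measurePreserving_reverse T)) u₁
  refine ⟨fun t => u (T - t), fun t => U (T - t), ?_, h2.reverse, by simpa using h3⟩
  have h4 := h1.reverse
  simpa only [Function.comp, sub_sub_cancel, neg_sub] using h4

end Evolution

/-! ### The direct and adjoint problems in operator form -/

variable {T : ℝ} {m : ℕ}

theorem HasTimeDeriv.isWeakTimeDeriv [CompleteSpace (ZeroBoundary m)] {u : ℝ → ZeroBoundary m}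
    {w : ℝ → StrongDual ℝ (ZeroBoundary m)} (hu : MemLp u 2 (timeMeasure T))
    (h : HasTimeDeriv T u w) :
    IsWeakTimeDeriv (wd 0) T u
      (fun t => (InnerProductSpace.toDual ℝ (ZeroBoundary m)).symm (w t)) where
  memLp_left := hu
  memLp_right := (InnerProductSpace.toDual ℝ (ZeroBoundary m)).symm.isometry.lipschitz.comp_memLp
    (map_zero _) h.1
  weak η hη φ := by
    simp only [InnerProductSpace.toDual_symm_apply]
    exact h.2 η hη φ

theorem IsWeakTimeDeriv.hasTimeDeriv [CompleteSpace (ZeroBoundary m)] {u w : ℝ → ZeroBoundary m}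
    (h : IsWeakTimeDeriv (wd 0) T u w) :
    HasTimeDeriv T u (fun t => InnerProductSpace.toDual ℝ (ZeroBoundary m) (w t)) := by
  refine ⟨(InnerProductSpace.toDual ℝ (ZeroBoundary m)).isometry.lipschitz.comp_memLp
    (map_zero _) h.memLp_right, fun η hη φ => ?_⟩
  simp only [InnerProductSpace.toDual_apply_apply]
  exact h.weak η hη φ

theorem hasTimeValue_iff [CompleteSpace (ZeroBoundary m)] {u : ℝ → ZeroBoundary m} {t₀ : ℝ}
    {a : L2} : HasTimeValue T u t₀ a ↔ ∃ U, IsContinuousRep (wd 0) T u U ∧ U t₀ = a :=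
  ⟨fun ⟨U, h1, h2, h3⟩ => ⟨U, ⟨h1, h2⟩, h3⟩, fun ⟨U, h1, h2⟩ => ⟨U, h1.1, h1.2, h2⟩⟩

theorem HasTimeValue.eq_rep [CompleteSpace (ZeroBoundary m)] (hT : 0 < T)
    {u : ℝ → ZeroBoundary m} {t₀ : ℝ} {a : L2} (h : HasTimeValue T u t₀ a) (ht : t₀ ∈ Icc 0 T)
    {U : ℝ → L2} (hU : IsContinuousRep (wd 0) T u U) : U t₀ = a := by
  obtain ⟨U', hU', rfl⟩ := hasTimeValue_iff.1 h
  exact hU.eqOn hU' hT ht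

/-- The Riesz representative in `V₀²` of the functional `φ ↦ (f, φ)_{L²}`. -/
noncomputable def loadV02 : L2 →L[ℝ] V02 := ContinuousLinearMap.adjoint (wd 0)

/-- The Riesz representative in `H¹₀` of the functional `φ ↦ (f, φ)_{L²}`. -/
noncomputable def loadH10 : L2 →L[ℝ] H10 := ContinuousLinearMap.adjoint (wd 0)

theorem inner_loadV02 (f : L2) (φ : V02) : ⟪loadV02 f, φ⟫_ℝ = ⟪f, wd 0 φ⟫_ℝ :=
  ContinuousLinearMap.adjoint_inner_left (wd 0) φ f

theorem inner_loadH10 (f : L2) (φ : H10) : ⟪loadH10 f, φ⟫_ℝ = ⟪f, wd 0 φ⟫_ℝ :=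
  ContinuousLinearMap.adjoint_inner_left (wd 0) φ f

theorem norm_loadV02_le (f : L2) : ‖loadV02 f‖ ≤ ‖f‖ := by
  have h : ‖loadV02 f‖ ^ 2 ≤ ‖f‖ * ‖loadV02 f‖ := by
    rw [← real_inner_self_eq_norm_sq, inner_loadV02]
    exact (real_inner_le_norm _ _).trans
      (mul_le_mul_of_nonneg_left (norm_wd_le _ _) (norm_nonneg _))
  by_contra! h1
  nlinarith [norm_nonneg f]

/-- The direct problem, with functionals replaced by their Riesz representatives. -/
structure IsDirectPair (T : ℝ) (d : Sobolev 1) (u wu : ℝ → V02) (v wv : ℝ → H10)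
    (U V : ℝ → L2) : Prop where
  deriv_u : IsWeakTimeDeriv (wd 0) T u wu
  deriv_v : IsWeakTimeDeriv (wd 0) T v wv
  rep_u : IsContinuousRep (wd 0) T u U
  rep_v : IsContinuousRep (wd 0) T v V
  eq_u : ∀ᵐ t ∂timeMeasure T, wu t = loadV02 (wd 0 (v t)) - bilaplacian (u t)
  eq_v : ∀ᵐ t ∂timeMeasure T, wv t = -diffusionOp d (v t)

/-- The adjoint problem, with functionals replaced by their Riesz representatives. -/
structure IsAdjointPair (T : ℝ) (d : Sobolev 1) (p wp : ℝ → V02) (q wq : ℝ → H10)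
    (P Q : ℝ → L2) : Prop where
  deriv_p : IsWeakTimeDeriv (wd 0) T p wp
  deriv_q : IsWeakTimeDeriv (wd 0) T q wq
  rep_p : IsContinuousRep (wd 0) T p P
  rep_q : IsContinuousRep (wd 0) T q Q
  eq_p : ∀ᵐ t ∂timeMeasure T, wp t = bilaplacian (p t)
  eq_q : ∀ᵐ t ∂timeMeasure T, wq t = diffusionOp d (q t) - loadH10 (wd 0 (p t))

theorem inner_bilaplacian (u φ : V02) : ⟪bilaplacian u, φ⟫_ℝ = ⟪wd 2 u, wd 2 φ⟫_ℝ :=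
  inner_gram_left (wd 2) u φ

/-- The equation for v is tested only on V₀²; density of V₀² in H¹₀ upgrades it to an identity in
H¹₀, so that it can be paired with q. -/
theorem IsDirectSolution.exists_pair {d : Sobolev 1} {u₀ v₀ : L2} {u : ℝ → V02}
    {v : ℝ → H10} (h : IsDirectSolution T d u₀ v₀ u v) :
    ∃ wu wv U V, IsDirectPair T d u wu v wv U V ∧ U 0 = u₀ ∧ V 0 = v₀ := by
  obtain ⟨u', hu', hue⟩ := h.equation_u
  obtain ⟨v', hv', hve⟩ := h.equation_v
  obtain ⟨U, hU, hU0⟩ := hasTimeValue_iff.1 h.initial_u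
  obtain ⟨V, hV, hV0⟩ := hasTimeValue_iff.1 h.initial_v
  refine ⟨_, _, U, V, ⟨hu'.isWeakTimeDeriv h.memLp_u, hv'.isWeakTimeDeriv h.memLp_v, hU, hV,
    ?_, ?_⟩, hU0, hV0⟩
  · filter_upwards [hue] with t ht
    refine ext_inner_right ℝ fun φ => ?_
    rw [InnerProductSpace.toDual_symm_apply, inner_sub_left, inner_loadV02, inner_bilaplacian]
    linarith [ht φ]
  · filter_upwards [hve] with t ht
    rw [eq_neg_iff_add_eq_zero]
    refine H10.eq_zero_of_inner_toH10 fun φ => ?_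
    rw [inner_add_left, InnerProductSpace.toDual_symm_apply, inner_diffusionOp]
    exact ht φ

theorem IsDirectPair.isDirectSolution {d : Sobolev 1} {u wu : ℝ → V02} {v wv : ℝ → H10}
    {U V : ℝ → L2} (h : IsDirectPair T d u wu v wv U V) :
    IsDirectSolution T d (U 0) (V 0) u v where
  memLp_u := h.deriv_u.memLp_left
  memLp_v := h.deriv_v.memLp_left
  equation_u := ⟨_, h.deriv_u.hasTimeDeriv, by
    filter_upwards [h.eq_u] with t ht φ
    rw [InnerProductSpace.toDual_apply_apply, ht, inner_sub_left, inner_loadV02, inner_bilaplacian]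
    ring⟩
  equation_v := ⟨_, h.deriv_v.hasTimeDeriv, by
    filter_upwards [h.eq_v] with t ht φ
    rw [InnerProductSpace.toDual_apply_apply, ht, inner_neg_left, inner_diffusionOp]
    ring⟩
  initial_u := hasTimeValue_iff.2 ⟨U, h.rep_u, rfl⟩
  initial_v := hasTimeValue_iff.2 ⟨V, h.rep_v, rfl⟩

theorem IsAdjointSolution.exists_pair {d : Sobolev 1} {pT qT : L2} {p : ℝ → V02}
    {q : ℝ → H10} (h : IsAdjointSolution T d pT qT p q) :
    ∃ wp wq P Q, IsAdjointPair T d p wp q wq P Q ∧ P T = pT ∧ Q T = qT := by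
  obtain ⟨p', hp', hpe⟩ := h.equation_p
  obtain ⟨q', hq', hqe⟩ := h.equation_q
  obtain ⟨P, hP, hP0⟩ := hasTimeValue_iff.1 h.final_p
  obtain ⟨Q, hQ, hQ0⟩ := hasTimeValue_iff.1 h.final_q
  refine ⟨_, _, P, Q, ⟨hp'.isWeakTimeDeriv h.memLp_p, hq'.isWeakTimeDeriv h.memLp_q, hP, hQ,
    ?_, ?_⟩, hP0, hQ0⟩
  · filter_upwards [hpe] with t ht
    refine ext_inner_right ℝ fun φ => ?_
    rw [InnerProductSpace.toDual_symm_apply, inner_bilaplacian]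
    linarith [ht φ]
  · filter_upwards [hqe] with t ht
    rw [← sub_eq_zero]
    refine H10.eq_zero_of_inner_toH10 fun φ => ?_
    rw [inner_sub_left, inner_sub_left, InnerProductSpace.toDual_symm_apply, inner_diffusionOp,
      inner_loadH10, V02.wd_zero_toH10]
    linarith [ht φ]

theorem IsAdjointPair.isAdjointSolution {d : Sobolev 1} {p wp : ℝ → V02} {q wq : ℝ → H10}
    {P Q : ℝ → L2} (h : IsAdjointPair T d p wp q wq P Q) :
    IsAdjointSolution T d (P T) (Q T) p q where
  memLp_p := h.deriv_p.memLp_left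
  memLp_q := h.deriv_q.memLp_left
  equation_p := ⟨_, h.deriv_p.hasTimeDeriv, by
    filter_upwards [h.eq_p] with t ht φ
    rw [InnerProductSpace.toDual_apply_apply, ht, inner_bilaplacian]
    ring⟩
  equation_q := ⟨_, h.deriv_q.hasTimeDeriv, by
    filter_upwards [h.eq_q] with t ht φ
    rw [InnerProductSpace.toDual_apply_apply, ht, inner_sub_left, inner_diffusionOp,
      inner_loadH10, V02.wd_zero_toH10]
    ring⟩
  final_p := hasTimeValue_iff.2 ⟨P, h.rep_p, rfl⟩
  final_q := hasTimeValue_iff.2 ⟨Q, h.rep_q, rfl⟩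

variable {d : Sobolev 1} {a : ℝ}

/-- The system is a cascade: the equation for v does not involve u, so it is solved first and v then
acts as the load for u. In the adjoint problem p comes first and drives q. -/
theorem exists_isDirectPair (hT : 0 < T) (ha : 0 < a)
    (hd : ∀ᵐ x ∂spaceMeasure, a ≤ Sobolev.wd 0 d x) (u₀ v₀ : L2) :
    ∃ u wu v wv U V, IsDirectPair T d u wu v wv U V ∧ U 0 = u₀ ∧ V 0 = v₀ := by
  obtain ⟨v, V, hv, hV, hV0⟩ := exists_evolution wd_zero_injective H10.denseRange_wd hT
    (diffusionOp_symm d) (half_pos ha) (diffusionOp_coercive ha.le hd)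
    (MemLp.zero (p := 2) (μ := timeMeasure T) : MemLp (fun _ : ℝ => (0 : H10)) _ _) v₀
  obtain ⟨u, U, hu, hU, hU0⟩ := exists_evolution wd_zero_injective V02.denseRange_wd hT
    bilaplacian_symm (by norm_num) bilaplacian_coercive
    ((loadV02.comp (wd 0)).comp_memLp' hv.memLp_left) u₀
  exact ⟨u, _, v, _, U, V, ⟨hu, hv, hU, hV, Eventually.of_forall fun t => rfl,
    Eventually.of_forall fun t => zero_sub _⟩, hU0, hV0⟩

theorem exists_isAdjointPair (hT : 0 < T) (ha : 0 < a)
    (hd : ∀ᵐ x ∂spaceMeasure, a ≤ Sobolev.wd 0 d x) (pT qT : L2) :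
    ∃ p wp q wq P Q, IsAdjointPair T d p wp q wq P Q ∧ P T = pT ∧ Q T = qT := by
  obtain ⟨p, P, hp, hP, hP0⟩ := exists_backward_evolution wd_zero_injective V02.denseRange_wd hT
    bilaplacian_symm (by norm_num) bilaplacian_coercive
    (MemLp.zero (p := 2) (μ := timeMeasure T) : MemLp (fun _ : ℝ => (0 : V02)) _ _) pT
  obtain ⟨q, Q, hq, hQ, hQ0⟩ := exists_backward_evolution wd_zero_injective H10.denseRange_wd hT
    (diffusionOp_symm d) (half_pos ha) (diffusionOp_coercive ha.le hd)
    ((loadH10.comp (wd 0)).comp_memLp' hp.memLp_left) qT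
  exact ⟨p, _, q, _, P, Q, ⟨hp, hq, hP, hQ, Eventually.of_forall fun t => sub_zero _,
    Eventually.of_forall fun t => rfl⟩, hP0, hQ0⟩

/-! ### Stability in the coefficient and uniqueness of the final state -/

variable {T : ℝ} {d : Sobolev 1} {a : ℝ}

theorem diffusionOp_sub (d e : Sobolev 1) (v : H10) :
    diffusionOp (d - e) v = diffusionOp d v - diffusionOp e v := by
  refine ext_inner_right ℝ fun φ => ?_
  rw [inner_sub_left, inner_diffusionOp', inner_diffusionOp', inner_diffusionOp', map_sub,
    _root_.sub_apply, inner_sub_left]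

theorem abs_inner_diffusionOp_le (d : Sobolev 1) (v φ : H10) :
    |⟪diffusionOp d v, φ⟫_ℝ| ≤ 2 * ‖d‖ * ‖v‖ * ‖φ‖ := by
  rw [inner_diffusionOp']
  refine (abs_real_inner_le_norm _ _).trans ?_
  have h1 := norm_mulL_le d (wd 1 v)
  have h2 : ‖wd 1 v‖ ≤ ‖v‖ := norm_wd_le v 1
  have h3 : ‖wd 1 φ‖ ≤ ‖φ‖ := norm_wd_le φ 1
  refine mul_le_mul (h1.trans ?_) h3 (norm_nonneg _) (by positivity)
  exact mul_le_mul_of_nonneg_left h2 (by positivity)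

theorem norm_diffusionOp_le (d : Sobolev 1) (v : H10) : ‖diffusionOp d v‖ ≤ 2 * ‖d‖ * ‖v‖ := by
  have h := abs_inner_diffusionOp_le d v (diffusionOp d v)
  rw [real_inner_self_eq_norm_sq, abs_of_nonneg (by positivity)] at h
  by_contra! h1
  have h2 : 0 ≤ 2 * ‖d‖ * ‖v‖ := by positivity
  nlinarith

/-- Lipschitz dependence of the direct problem on the coefficient. -/
theorem IsDirectPair.stability (hT : 0 < T) (ha : 0 < a) {e : Sobolev 1}
    (he : ∀ᵐ x ∂spaceMeasure, a ≤ Sobolev.wd 0 e x)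
    {u wu y wy : ℝ → V02} {v wv z wz : ℝ → H10} {U V Y Z : ℝ → L2}
    (h : IsDirectPair T d u wu v wv U V) (h' : IsDirectPair T e y wy z wz Y Z)
    (hU : Y 0 = U 0) (hV : Z 0 = V 0) :
    a / 2 * ‖Z T - V T‖ ^ 2 + (a / 2) ^ 2 * ∫ t, ‖z t - v t‖ ^ 2 ∂timeMeasure T ≤
        4 * ‖e - d‖ ^ 2 * ∫ t, ‖v t‖ ^ 2 ∂timeMeasure T ∧
      1 / 3 * ‖Y T - U T‖ ^ 2 ≤ ∫ t, ‖z t - v t‖ ^ 2 ∂timeMeasure T := by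
  -- Writing A_e z - A_d v = A_e (z - v) + A_{e-d} v gives the difference a coercive equation with
  -- this source. Its bound 2‖e - d‖‖v‖, squared, produces the factor 4.
  have hfv : MemLp (fun t => -diffusionOp (e - d) (v t)) 2 (timeMeasure T) :=
    ((diffusionOp (e - d)).comp_memLp' h.deriv_v.memLp_left).neg
  have hΔ := h'.deriv_v.sub h.deriv_v
  have h1 := hΔ.energy_le wd_zero_injective hT (half_pos ha) (diffusionOp_coercive ha.le he) hfv
    (by
      filter_upwards [h.eq_v, h'.eq_v] with t g1 g2
      rw [g1, g2, diffusionOp_sub, map_sub]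
      abel) (h'.rep_v.sub h.rep_v) (by rw [hV, sub_self])
  have hfu : MemLp (fun t => loadV02 (wd 0 (z t - v t))) 2 (timeMeasure T) :=
    (loadV02.comp (wd 0)).comp_memLp' hΔ.memLp_left
  have h2 := (h'.deriv_u.sub h.deriv_u).energy_le wd_zero_injective hT (by norm_num)
    bilaplacian_coercive hfu (by
      filter_upwards [h.eq_u, h'.eq_u] with t g1 g2
      rw [g1, g2]
      simp only [map_sub]
      abel) (h'.rep_u.sub h.rep_u) (by rw [hU, sub_self])
  refine ⟨h1.trans ?_, ?_⟩
  · rw [← integral_const_mul]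
    refine integral_mono (integrable_norm_sq_of_memLp hfv)
      ((integrable_norm_sq_of_memLp h.deriv_v.memLp_left).const_mul _) fun t => ?_
    have h3 := pow_le_pow_left₀ (norm_nonneg _) (norm_diffusionOp_le (e - d) (v t)) 2
    rw [norm_neg]
    refine h3.trans (le_of_eq (by ring))
  · have h3 : ∫ t, ‖loadV02 (wd 0 (z t - v t))‖ ^ 2 ∂timeMeasure T ≤
        ∫ t, ‖z t - v t‖ ^ 2 ∂timeMeasure T := by
      refine integral_mono (integrable_norm_sq_of_memLp hfu)
        (integrable_norm_sq_of_memLp hΔ.memLp_left) fun t => ?_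
      exact pow_le_pow_left₀ (norm_nonneg _) ((norm_loadV02_le _).trans (norm_wd_le _ _)) 2
    have h4 : 0 ≤ ∫ t, ‖y t - u t‖ ^ 2 ∂timeMeasure T := integral_nonneg fun t => by positivity
    nlinarith

/-- Uniqueness is the stability estimate for two solutions with the same coefficient, whose
right-hand side is then zero. -/
theorem existsUnique_isFinalState (hT : 0 < T) (ha : 0 < a)
    (hd : ∀ᵐ x ∂spaceMeasure, a ≤ Sobolev.wd 0 d x) (u₀ v₀ : L2) :
    ∃! s : L2 × L2, IsFinalState T u₀ v₀ d s := by
  obtain ⟨u, wu, v, wv, U, V, h, rfl, rfl⟩ := exists_isDirectPair hT ha hd u₀ v₀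
  refine ⟨(U T, V T), ⟨u, v, h.isDirectSolution, hasTimeValue_iff.2 ⟨U, h.rep_u, rfl⟩,
    hasTimeValue_iff.2 ⟨V, h.rep_v, rfl⟩⟩, ?_⟩
  rintro ⟨s1, s2⟩ ⟨y, z, hs, h1, h2⟩
  obtain ⟨wy, wz, Y, Z, h', hY, hZ⟩ := hs.exists_pair
  have hT1 : T ∈ Icc 0 T := right_mem_Icc.2 hT.le
  obtain rfl : Y T = s1 := h1.eq_rep hT hT1 h'.rep_u
  obtain rfl : Z T = s2 := h2.eq_rep hT hT1 h'.rep_v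
  obtain ⟨h3, h4⟩ := h.stability hT ha hd h' hY hZ
  rw [sub_self, norm_zero] at h3
  have h5 : 0 ≤ ∫ t, ‖z t - v t‖ ^ 2 ∂timeMeasure T := integral_nonneg fun t => by positivity
  have h6 : (0 : ℝ) < (a / 2) ^ 2 := by positivity
  have h7 : 0 ≤ a / 2 * ‖Z T - V T‖ ^ 2 := by positivity
  have h8 : ∫ t, ‖z t - v t‖ ^ 2 ∂timeMeasure T = 0 := by
    refine le_antisymm ?_ h5
    by_contra! h9
    have := mul_pos h6 h9
    linarith
  rw [h8] at h3 h4
  have h9 : ‖Z T - V T‖ ^ 2 = 0 := by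
    refine le_antisymm ?_ (by positivity)
    by_contra! h10
    have := mul_pos (half_pos ha) h10
    linarith
  have h10 : ‖Y T - U T‖ ^ 2 = 0 := le_antisymm (by linarith) (by positivity)
  rw [sq_eq_zero_iff, norm_eq_zero, sub_eq_zero] at h9 h10
  rw [h9, h10]

theorem finalState_eq {u₀ v₀ : L2} (h : ∃! s : L2 × L2, IsFinalState T u₀ v₀ d s) {s : L2 × L2}
    (hs : IsFinalState T u₀ v₀ d s) : finalState T u₀ v₀ d = s := by
  have h1 : ∃ s, IsFinalState T u₀ v₀ d s := ⟨s, hs⟩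
  rw [finalState, dif_pos h1]
  exact h.unique h1.choose_spec hs

theorem IsDirectPair.finalState_eq (hT : 0 < T) (ha : 0 < a)
    (hd : ∀ᵐ x ∂spaceMeasure, a ≤ Sobolev.wd 0 d x) {u wu : ℝ → V02} {v wv : ℝ → H10}
    {U V : ℝ → L2} (h : IsDirectPair T d u wu v wv U V) :
    finalState T (U 0) (V 0) d = (U T, V T) :=
  Cascade.finalState_eq (existsUnique_isFinalState hT ha hd _ _)
    ⟨u, v, h.isDirectSolution, hasTimeValue_iff.2 ⟨U, h.rep_u, rfl⟩,
      hasTimeValue_iff.2 ⟨V, h.rep_v, rfl⟩⟩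

/-! ### The flux product and the duality relation -/

/-- The pointwise product of `L²` functions as a bounded bilinear map into `L¹`. -/
noncomputable def mulL2L1 : L2 →L[ℝ] L2 →L[ℝ] Lp ℝ 1 spaceMeasure :=
  (ContinuousLinearMap.mul ℝ ℝ).holderL spaceMeasure 2 2 1

theorem mulL2L1_ae (f g : L2) : ∀ᵐ x ∂spaceMeasure, mulL2L1 f g x = f x * g x :=
  (ContinuousLinearMap.mul ℝ ℝ).coeFn_holder (r := 1) f g

theorem mulL2L1_eq_smul (f g : L2) : mulL2L1 f g = (f • g : Lp ℝ 1 spaceMeasure) := by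
  refine Lp.ext ?_
  filter_upwards [mulL2L1_ae f g, Lp.coeFn_lpSMul (r := 1) f g] with x h1 h2
  rw [h1, h2]
  rfl

theorem pairing_mulL2L1 (δ : Sobolev 1) (f g : L2) :
    pairing δ (mulL2L1 f g) = ⟪mulL δ g, f⟫_ℝ := by
  rw [pairing_eq, inner_mulL]
  refine integral_congr_ae ?_
  filter_upwards [mulL2L1_ae f g] with x hx
  rw [hx]
  ring

/-- Integration against δ is a bounded functional on L¹(0,1), so it commutes with the Bochner
integral in time; no Fubini argument is needed. -/
theorem pairing_fluxProduct {v q : ℝ → H10} (hv : MemLp v 2 (timeMeasure T))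
    (hq : MemLp q 2 (timeMeasure T)) (δ : Sobolev 1) :
    pairing δ (fluxProduct T v q) = ∫ t, ⟪diffusionOp δ (v t), q t⟫_ℝ ∂timeMeasure T := by
  have hi : Integrable (fun t => mulL2L1 (wd 1 (q t)) (wd 1 (v t))) (timeMeasure T) :=
    memLp_one_iff_integrable.1 (mulL2L1.memLp_of_bilin 1 ((wd 1).comp_memLp' hq)
      ((wd 1).comp_memLp' hv))
  simp only [fluxProduct, ← mulL2L1_eq_smul]
  rw [← (pairing δ).integral_comp_comm hi]
  simp only [pairing_mulL2L1, inner_diffusionOp']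

/-- The duality relation between the direct and the adjoint problem. -/
theorem IsDirectPair.duality (hT : 0 < T) {e : Sobolev 1}
    {u wu y wy p wp : ℝ → V02} {v wv z wz q wq : ℝ → H10} {U V Y Z P Q : ℝ → L2}
    (h : IsDirectPair T d u wu v wv U V) (h' : IsDirectPair T e y wy z wz Y Z)
    (hU : Y 0 = U 0) (hV : Z 0 = V 0) (hp : IsAdjointPair T d p wp q wq P Q) :
    ⟪Y T - U T, P T⟫_ℝ + ⟪Z T - V T, Q T⟫_ℝ =
      -(∫ t, ⟪diffusionOp (e - d) (v t), q t⟫_ℝ ∂timeMeasure T) -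
        ∫ t, ⟪diffusionOp (e - d) (z t - v t), q t⟫_ℝ ∂timeMeasure T := by
  have hΔv := h'.deriv_v.sub h.deriv_v
  have h1 := (h'.deriv_u.sub h.deriv_u).inner_sub_inner wd_zero_injective hT hp.deriv_p
    (h'.rep_u.sub h.rep_u) hp.rep_p
  have h2 := hΔv.inner_sub_inner wd_zero_injective hT hp.deriv_q (h'.rep_v.sub h.rep_v) hp.rep_q
  rw [hU, sub_self, inner_zero_left, sub_zero] at h1
  rw [hV, sub_self, inner_zero_left, sub_zero] at h2
  -- The biharmonic terms cancel by symmetry and leave the coupling ∫(Δv, p). The equation for q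
  -- contributes the same term with the opposite sign in `h4`.
  have h3 : ⟪Y T - U T, P T⟫_ℝ =
      ∫ t, ⟪wd 0 (z t - v t), wd 0 (p t)⟫_ℝ ∂timeMeasure T := by
    rw [h1]
    refine integral_congr_ae ?_
    filter_upwards [h.eq_u, h'.eq_u, hp.eq_p] with t g1 g2 g3
    rw [g1, g2, g3, ← bilaplacian_symm, map_sub, map_sub, ← inner_loadV02, map_sub]
    simp only [inner_sub_left]
    ring
  have i0 : Integrable (fun t => ⟪wd 0 (z t - v t), wd 0 (p t)⟫_ℝ) (timeMeasure T) :=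
    integrable_inner_of_memLp ((wd 0).comp_memLp' hΔv.memLp_left)
      ((wd 0).comp_memLp' hp.deriv_p.memLp_left)
  have i1 : Integrable (fun t => ⟪diffusionOp (e - d) (v t), q t⟫_ℝ) (timeMeasure T) :=
    integrable_inner_of_memLp ((diffusionOp (e - d)).comp_memLp' h.deriv_v.memLp_left)
      hp.deriv_q.memLp_left
  have i2 : Integrable (fun t => ⟪diffusionOp (e - d) (z t - v t), q t⟫_ℝ) (timeMeasure T) :=
    integrable_inner_of_memLp ((diffusionOp (e - d)).comp_memLp' hΔv.memLp_left)
      hp.deriv_q.memLp_left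
  rw [h2, h3, ← integral_neg, ← integral_sub i1.fun_neg i2]
  have h4 : ∫ t, (⟪z t - v t, wq t⟫_ℝ + ⟪wz t - wv t, q t⟫_ℝ) ∂timeMeasure T =
      ∫ t, (-⟪diffusionOp (e - d) (v t), q t⟫_ℝ - ⟪diffusionOp (e - d) (z t - v t), q t⟫_ℝ -
        ⟪wd 0 (z t - v t), wd 0 (p t)⟫_ℝ) ∂timeMeasure T := by
    refine integral_congr_ae ?_
    filter_upwards [h.eq_v, h'.eq_v, hp.eq_q] with t g1 g2 g3
    rw [g1, g2, g3, inner_sub_right, ← diffusionOp_symm,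
      real_inner_comm (loadH10 _) (z t - v t), inner_loadH10,
      diffusionOp_sub, diffusionOp_sub, real_inner_comm (wd 0 (p t)) (wd 0 (z t - v t))]
    simp only [map_sub, inner_sub_left, inner_neg_left, inner_sub_right]
    ring
  have h5 := integral_sub (i1.neg.sub i2) i0
  simp only [Pi.sub_apply, Pi.neg_apply] at h5
  rw [h4, h5]
  ring

/-! ### First-order expansion of the functional -/

theorem inner_add_smul_sub {E : Type*} [NormedAddCommGroup E] [InnerProductSpace ℝ E] (γ : ℝ)
    (L x y : E) : γ / 2 * ‖y‖ ^ 2 - γ / 2 * ‖x‖ ^ 2 - ⟪L + γ • x, y - x⟫_ℝ =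
      γ / 2 * ‖y - x‖ ^ 2 - ⟪L, y - x⟫_ℝ := by
  rw [inner_add_left, real_inner_smul_left, norm_sub_sq_real, inner_sub_right x,
    real_inner_self_eq_norm_sq, real_inner_comm x y]
  ring

theorem half_norm_sub_sq {E : Type*} [NormedAddCommGroup E] [InnerProductSpace ℝ E]
    (x y z : E) : 1 / 2 * ‖y - z‖ ^ 2 - 1 / 2 * ‖x - z‖ ^ 2 =
      1 / 2 * ‖y - x‖ ^ 2 + ⟪y - x, x - z⟫_ℝ := by
  have h : y - z = (y - x) + (x - z) := by abel
  rw [h, norm_add_sq_real]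
  ring

theorem ae_le_of_mem_admissible {α₀ α₁ α₂ : ℝ} (h : d ∈ admissible α₀ α₁ α₂) :
    ∀ᵐ x ∂spaceMeasure, α₀ ≤ Sobolev.wd 0 d x := by
  filter_upwards [h.1] with x hx using hx.1

/-- The first order expansion of the Tikhonov functional with quadratic remainder. -/
theorem tikhonov_expansion {γ α₀ α₁ α₂ : ℝ} (hT : 0 < T) (hα₀ : 0 < α₀) {m₁ m₂ : L2}
    (hd : d ∈ admissible α₀ α₁ α₂) {u wu p wp : ℝ → V02} {v wv q wq : ℝ → H10}
    {U V P Q : ℝ → L2} (h : IsDirectPair T d u wu v wv U V)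
    (hp : IsAdjointPair T d p wp q wq P Q) (hP : P T = U T - m₁) (hQ : Q T = V T - m₂)
    {Λ : Sobolev 1} (hΛ : IsNeumannSolution (fluxProduct T v q) Λ) :
    ∃ C, ∀ e ∈ admissible α₀ α₁ α₂,
      |tikhonov T γ (U 0) (V 0) m₁ m₂ e - tikhonov T γ (U 0) (V 0) m₁ m₂ d -
        ⟪Λ + γ • d, e - d⟫_ℝ| ≤ C * ‖e - d‖ ^ 2 := by
  set E := ∫ t, ‖v t‖ ^ 2 ∂timeMeasure T
  set F := ∫ t, ‖q t‖ ^ 2 ∂timeMeasure T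
  set c := α₀ / 2
  have hc : 0 < c := half_pos hα₀
  -- The summands bound, in order, ½‖Δu(T)‖² ≤ (3/2) D, ½‖Δv(T)‖², the penalty term, and the duality
  -- remainder |R| ≤ D + n² F. Here D ≤ (4E/c²) n².
  refine ⟨3 / 2 * (4 * E / c ^ 2) + 1 / 2 * (4 * E / c) + |γ| / 2 + (4 * E / c ^ 2 + F),
    fun e he => ?_⟩
  obtain ⟨y, wy, z, wz, Y, Z, h', hY, hZ⟩ :=
    exists_isDirectPair hT hα₀ (ae_le_of_mem_admissible he) (U 0) (V 0)
  have f1 := h.finalState_eq hT hα₀ (ae_le_of_mem_admissible hd)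
  have f2 := h'.finalState_eq hT hα₀ (ae_le_of_mem_admissible he)
  rw [hY, hZ] at f2
  obtain ⟨s1, s2⟩ := h.stability hT hα₀ (ae_le_of_mem_admissible he) h' hY hZ
  have hdual := h.duality hT h' hY hZ hp
  have hΛ' := hΛ.inner_eq (e - d)
  rw [pairing_fluxProduct h.deriv_v.memLp_left hp.deriv_q.memLp_left] at hΛ'
  set D := ∫ t, ‖z t - v t‖ ^ 2 ∂timeMeasure T
  set R := ∫ t, ⟪diffusionOp (e - d) (z t - v t), q t⟫_ℝ ∂timeMeasure T
  set n := ‖e - d‖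
  change c * ‖Z T - V T‖ ^ 2 + c ^ 2 * D ≤ 4 * n ^ 2 * E at s1
  have hD0 : 0 ≤ D := integral_nonneg fun t => by positivity
  have hΔ := h'.deriv_v.sub h.deriv_v
  have hR : |R| ≤ D + n ^ 2 * F := by
    have i1 := integrable_norm_sq_of_memLp hΔ.memLp_left
    have i2 := (integrable_norm_sq_of_memLp hp.deriv_q.memLp_left).const_mul (n ^ 2)
    rw [← Real.norm_eq_abs, ← integral_const_mul, ← integral_add i1 i2]
    refine norm_integral_le_of_norm_le (i1.add i2) (Eventually.of_forall fun t => ?_)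
    refine (abs_inner_diffusionOp_le (e - d) (z t - v t) (q t)).trans ?_
    change 2 * n * ‖z t - v t‖ * ‖q t‖ ≤ ‖z t - v t‖ ^ 2 + n ^ 2 * ‖q t‖ ^ 2
    nlinarith [sq_nonneg (‖z t - v t‖ - n * ‖q t‖)]
  have hD : D ≤ 4 * E / c ^ 2 * n ^ 2 := by
    rw [div_mul_eq_mul_div, le_div_iff₀ (by positivity)]
    have : 0 ≤ c * ‖Z T - V T‖ ^ 2 := by positivity
    linarith
  have hZV : ‖Z T - V T‖ ^ 2 ≤ 4 * E / c * n ^ 2 := by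
    rw [div_mul_eq_mul_div, le_div_iff₀ hc]
    have : 0 ≤ c ^ 2 * D := by positivity
    linarith
  -- All first-order terms cancel: the cross terms of the squares are the left side of the duality
  -- relation, whose linear part equals ⟪Λ, e - d⟫.
  have hexp : tikhonov T γ (U 0) (V 0) m₁ m₂ e - tikhonov T γ (U 0) (V 0) m₁ m₂ d -
      ⟪Λ + γ • d, e - d⟫_ℝ =
      1 / 2 * ‖Y T - U T‖ ^ 2 + 1 / 2 * ‖Z T - V T‖ ^ 2 + γ / 2 * n ^ 2 - R := by
    simp only [tikhonov, f1, f2]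
    have e1 := half_norm_sub_sq (U T) (Y T) m₁
    have e2 := half_norm_sub_sq (V T) (Z T) m₂
    have e3 := inner_add_smul_sub γ Λ d e
    rw [← hP] at e1
    rw [← hQ] at e2
    simp only [hP, hQ] at *
    linarith
  have hγn : |γ / 2 * n ^ 2| ≤ |γ| / 2 * n ^ 2 := by
    rw [abs_mul, abs_div, abs_two, abs_of_nonneg (sq_nonneg n)]
  rw [hexp]
  have hY0 : 0 ≤ ‖Y T - U T‖ ^ 2 := by positivity
  have hZ0 : 0 ≤ ‖Z T - V T‖ ^ 2 := by positivity
  rw [abs_le] at hR hγn ⊢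
  constructor <;> nlinarith

/-! ### Geometry of the admissible set and conclusion -/

theorem convex_admissible (α₀ α₁ α₂ : ℝ) : Convex ℝ (admissible α₀ α₁ α₂) := by
  intro x hx y hy s t hs ht hst
  refine ⟨?_, ?_⟩
  · rw [map_add, map_smul, map_smul]
    filter_upwards [hx.1, hy.1, Lp.coeFn_add (s • Sobolev.wd 0 x) (t • Sobolev.wd 0 y),
      Lp.coeFn_smul s (Sobolev.wd 0 x), Lp.coeFn_smul t (Sobolev.wd 0 y)] with r h1 h2 h3 h4 h5
    rw [h3, Pi.add_apply, h4, h5, Pi.smul_apply, Pi.smul_apply, smul_eq_mul, smul_eq_mul]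
    obtain rfl : s = 1 - t := by linarith
    constructor <;> nlinarith
  · refine (norm_add_le _ _).trans ?_
    rw [norm_smul, norm_smul, Real.norm_of_nonneg hs, Real.norm_of_nonneg ht]
    obtain rfl : s = 1 - t := by linarith
    nlinarith [hx.2, hy.2]

/-- A ball of radius κ around the constant α₀ + 2κ works. By the embedding constant 2 its elements
take values in [α₀, α₀ + 4κ]; since the constant 1 has H¹ norm 1, their norms are at most α₀ + 3κ.
Hence κ is a quarter of the smaller gap. -/
theorem interior_admissible_nonempty {α₀ α₁ α₂ : ℝ} (hα₀ : 0 < α₀) (h1 : α₀ < α₁)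
    (h2 : α₀ < α₂) : (interior (admissible α₀ α₁ α₂)).Nonempty := by
  set κ := min (α₁ - α₀) (α₂ - α₀) / 4
  have hκ : 0 < κ := by
    have : 0 < min (α₁ - α₀) (α₂ - α₀) := lt_min (by linarith) (by linarith)
    positivity
  have hκ1 : 4 * κ ≤ α₁ - α₀ := by
    have := min_le_left (α₁ - α₀) (α₂ - α₀)
    simp only [κ]; linarith
  have hκ2 : 4 * κ ≤ α₂ - α₀ := by
    have := min_le_right (α₁ - α₀) (α₂ - α₀)
    simp only [κ]; linarith
  set o : Sobolev 1 := Sobolev.mkOne hasWeakDeriv_oneL2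
  have ho : ‖o‖ = 1 := by
    have h3 : ‖o‖ ^ 2 = 1 := by
      rw [Sobolev.norm_sq_eq, Fin.sum_univ_two, Sobolev.wd_zero_mkOne, Sobolev.wd_one_mkOne,
        ← real_inner_self_eq_norm_sq, inner_oneL2, integral_congr_ae oneL2_ae]
      simp
    exact (pow_eq_one_iff_of_nonneg (norm_nonneg o) two_ne_zero).1 h3
  refine ⟨(α₀ + 2 * κ) • o, mem_interior.2 ⟨Metric.ball ((α₀ + 2 * κ) • o) κ, ?_,
    Metric.isOpen_ball, Metric.mem_ball_self hκ⟩⟩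
  intro z hz
  rw [Metric.mem_ball, dist_eq_norm] at hz
  refine ⟨?_, ?_⟩
  · have h4 := (z - (α₀ + 2 * κ) • o).ae_abs_le
    rw [map_sub, map_smul, Sobolev.wd_zero_mkOne] at h4
    filter_upwards [h4, Lp.coeFn_sub (Sobolev.wd 0 z) ((α₀ + 2 * κ) • oneL2),
      Lp.coeFn_smul (α₀ + 2 * κ) oneL2, oneL2_ae] with x g1 g2 g3 g4
    rw [g2, Pi.sub_apply, g3, Pi.smul_apply, g4, smul_eq_mul, mul_one, Real.norm_eq_abs,
      abs_le] at g1
    constructor <;> linarith [g1.1, g1.2]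
  · have h3 := norm_sub_norm_le z ((α₀ + 2 * κ) • o)
    rw [norm_smul, ho, mul_one, Real.norm_of_nonneg (by positivity)] at h3
    linarith

end Cascade

open Cascade
theorem theoremT4p1 (T γ α₀ α₁ α₂ : ℝ) (hT : 0 < T) (hγ : 0 < γ) (hα₀ : 0 < α₀)
    (u₀ v₀ m₁ m₂ : Cascade.L2) (d : Cascade.Sobolev 1)
    (hd : d ∈ Cascade.admissible α₀ α₁ α₂) :
    (∃! s : Cascade.L2 × Cascade.L2, IsFinalState T u₀ v₀ d s) ∧
    (∃ (u : ℝ → V02) (v : ℝ → H10) (uT vT : Cascade.L2) (p : ℝ → V02) (q : ℝ → H10)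
      (Λ : Cascade.Sobolev 1),
      IsDirectSolution T d u₀ v₀ u v ∧
      HasTimeValue T u T uT ∧ HasTimeValue T v T vT ∧
      IsAdjointSolution T d (uT - m₁) (vT - m₂) p q ∧
      IsNeumannSolution (fluxProduct T v q) Λ) ∧
    (∀ (u : ℝ → V02) (v : ℝ → H10) (uT vT : Cascade.L2) (p : ℝ → V02) (q : ℝ → H10)
      (Λ : Cascade.Sobolev 1),
      IsDirectSolution T d u₀ v₀ u v →
      HasTimeValue T u T uT → HasTimeValue T v T vT →
      IsAdjointSolution T d (uT - m₁) (vT - m₂) p q →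
      IsNeumannSolution (fluxProduct T v q) Λ →
      HasGradientWithinAt (tikhonov T γ u₀ v₀ m₁ m₂) (Λ + γ • d)
        (Cascade.admissible α₀ α₁ α₂) d ∧
      (α₀ < α₁ → α₀ < α₂ → ∀ g : Cascade.Sobolev 1,
        HasGradientWithinAt (tikhonov T γ u₀ v₀ m₁ m₂) g (Cascade.admissible α₀ α₁ α₂) d →
          g = Λ + γ • d)) := by
  have hd' := ae_le_of_mem_admissible hd
  refine ⟨existsUnique_isFinalState hT hα₀ hd' u₀ v₀, ?_, ?_⟩
  · obtain ⟨u, wu, v, wv, U, V, h, rfl, rfl⟩ := exists_isDirectPair hT hα₀ hd' u₀ v₀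
    obtain ⟨p, wp, q, wq, P, Q, hp, hP, hQ⟩ :=
      exists_isAdjointPair hT hα₀ hd' (U T - m₁) (V T - m₂)
    obtain ⟨Λ, hΛ⟩ := exists_isNeumannSolution (fluxProduct T v q)
    refine ⟨u, v, U T, V T, p, q, Λ, h.isDirectSolution, hasTimeValue_iff.2 ⟨U, h.rep_u, rfl⟩,
      hasTimeValue_iff.2 ⟨V, h.rep_v, rfl⟩, ?_, hΛ⟩
    rw [← hP, ← hQ]
    exact hp.isAdjointSolution
  · intro u v uT vT p q Λ hs hu hv hpq hΛ
    obtain ⟨wu, wv, U, V, h, rfl, rfl⟩ := hs.exists_pair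
    obtain ⟨wp, wq, P, Q, hp, hP, hQ⟩ := hpq.exists_pair
    have hT1 : T ∈ Icc 0 T := right_mem_Icc.2 hT.le
    rw [← hu.eq_rep hT hT1 h.rep_u] at hP
    rw [← hv.eq_rep hT hT1 h.rep_v] at hQ
    obtain ⟨C, hC⟩ := tikhonov_expansion (γ := γ) hT hα₀ hd h hp hP hQ hΛ
    have hgrad : HasGradientWithinAt (tikhonov T γ (U 0) (V 0) m₁ m₂) (Λ + γ • d)
        (Cascade.admissible α₀ α₁ α₂) d := by
      rw [hasGradientWithinAt_iff_hasFDerivWithinAt, hasFDerivWithinAt_iff_isLittleO]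
      have hO : (fun e => tikhonov T γ (U 0) (V 0) m₁ m₂ e - tikhonov T γ (U 0) (V 0) m₁ m₂ d -
          InnerProductSpace.toDual ℝ (Sobolev 1) (Λ + γ • d) (e - d)) =O[
            nhdsWithin d (Cascade.admissible α₀ α₁ α₂)] fun e => ‖e - d‖ ^ 2 := by
        refine Asymptotics.IsBigO.of_bound C ?_
        filter_upwards [self_mem_nhdsWithin] with e he
        rw [InnerProductSpace.toDual_apply_apply, Real.norm_eq_abs,
          Real.norm_of_nonneg (sq_nonneg ‖e - d‖)]
        exact hC e he
      exact hO.trans_isLittleO (Asymptotics.isLittleO_pow_sub_sub d one_lt_two |>.mono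
        nhdsWithin_le_nhds)
    refine ⟨hgrad, fun h1 h2 g hg => ?_⟩
    -- A convex set with nonempty interior has unique derivatives at all its points, so `d` may lie
    -- on the boundary of the admissible set.
    have hu := uniqueDiffOn_convex (convex_admissible α₀ α₁ α₂)
      (interior_admissible_nonempty hα₀ h1 h2) d hd
    exact (InnerProductSpace.toDual ℝ (Sobolev 1)).injective
      (hu.eq hg.hasFDerivWithinAt hgrad.hasFDerivWithinAt)
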